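/- Let $M$ be a smooth manifold of dimension $2n+1$ with a paracontact metric structure $(\tilde\varphi,\xi,\eta,\tilde g)$. This means that $\tilde\varphi$ is a smooth $(1,1)$-tensor field, $\xi$ a smooth vector field, $\eta$ a smooth $1$-form and $\tilde g$ a smooth pseudo-Riemannian metric such that $\eta(\xi)=1$, $\tilde\varphi^2=I-\eta\otimes\xi$, the eigendistributions of $\tilde\varphi$ for the eigenvalues $1$ and $-1$ both have rank $n$, and, for all vector fields $X,Y$, $$\tilde g(\tilde\varphi X,\tilde\varphi Y)=-\tilde g(X,Y)+\eta(X)\eta(Y),\qquad d\eta(X,Y)=\tilde g(X,\tilde\varphi Y),$$ where $2\,d\eta(X,Y)=X(\eta(Y))-Y(\eta(X))-\eta([X,Y])$. Let $\tilde h=\frac12\mathcal L_\xi\tilde\varphi$, let $\tilde\nabla$ be the Levi-Civita connection of $\tilde g$, and let $\tilde R_{XY}Z=\tilde\nabla_X\tilde\nabla_YZ-\tilde\nabla_Y\tilde\nabla_XZ-\tilde\nabla_{[X,Y]}Z$ be its curvature. Suppose that for some real constants $\tilde\kappa>-1$ and $\tilde\mu$, $$\tilde R_{XY}\xi=\tilde\kappa\bigl(\eta(Y)X-\eta(X)Y\bigr)+\tilde\mu\bigl(\eta(Y)\tilde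 hX-\eta(X)\tilde hY\bigr)\qquad\text{for all vector fields }X,Y$$ (that is, $M$ is a paracontact $(\tilde\kappa,\tilde\mu)$-manifold with $\tilde\kappa>-1$). Put $\tilde\lambda=\sqrt{1+\tilde\kappa}$ and let $\mathcal D_{\tilde h}(\pm\tilde\lambda)$ be the eigendistributions of $\tilde h$ for the eigenvalues $\pm\tilde\lambda$. Then the following hold. (a) For all $X,X',X''\in\mathcal D_{\tilde h}(\tilde\lambda)$ and $Y,Y',Y''\in\mathcal D_{\tilde h}(-\tilde\lambda)$, \begin{align*} \tilde R_{XX'}X''&=(2(\tilde\lambda-1)+\tilde\mu)\bigl(\tilde g(X',X'')X-\tilde g(X,X'')X'\bigr),\\ \tilde R_{XX'}Y&=(\tilde\kappa+\tilde\mu)\bigl(-\tilde g(\tilde\varphi X',Y)\tilde\varphi X+\tilde g(\tilde\varphi X,Y)\tilde\varphi X'\bigr),\\ \tilde R_{XY}X'&=\tilde\kappa\,\tilde g(\tilde\varphi Y,X')\tilde\varphi X-\tilde\mu\,\tilde g(\tilde\varphi Y,X)\tilde\varphi X',\\ \tilde R_{XY}Y'&=-\tilde\kappa\,\tilde g(\tilde\varphi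 X,Y')\tilde\varphi Y+\tilde\mu\,\tilde g(\tilde\varphi X,Y)\tilde\varphi Y',\\ \tilde R_{YY'}X&=(\tilde\kappa+\tilde\mu)\bigl(-\tilde g(\tilde\varphi Y',X)\tilde\varphi Y+\tilde g(\tilde\varphi Y,X)\tilde\varphi Y'\bigr),\\ \tilde R_{YY'}Y''&=(-2(\tilde\lambda+1)+\tilde\mu)\bigl(\tilde g(Y',Y'')Y-\tilde g(Y,Y'')Y'\bigr). \end{align*} (b) For all vector fields $X,Y,Z,W$ on $M$, \begin{align*} \tilde g(\tilde R_{XY}Z,W)={}&\Bigl(-1+\tfrac{\tilde\mu}2\Bigr)\bigl(\tilde g(Y,Z)\tilde g(X,W)-\tilde g(X,Z)\tilde g(Y,W)\bigr)\\ &+\tilde g(Y,Z)\tilde g(\tilde hX,W)-\tilde g(X,Z)\tilde g(\tilde hY,W)-\tilde g(Y,W)\tilde g(\tilde hX,Z)+\tilde g(X,W)\tilde g(\tilde hY,Z)\\ &+\frac{-1+\frac{\tilde\mu}2}{\tilde\kappa+1}\bigl(\tilde g(\tilde hY,Z)\tilde g(\tilde hX,W)-\tilde g(\tilde hX,Z)\tilde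 g(\tilde hY,W)\bigr)\\ &-\frac{\tilde\mu}2\bigl(\tilde g(\tilde\varphi Y,Z)\tilde g(\tilde\varphi X,W)-\tilde g(\tilde\varphi X,Z)\tilde g(\tilde\varphi Y,W)\bigr)\\ &+\frac{-\tilde\kappa-\frac{\tilde\mu}2}{\tilde\kappa+1}\bigl(\tilde g(\tilde\varphi\tilde hY,Z)\tilde g(\tilde\varphi\tilde hX,W)-\tilde g(\tilde\varphi\tilde hY,W)\tilde g(\tilde\varphi\tilde hX,Z)\bigr)\\ &+\tilde\mu\,\tilde g(\tilde\varphi X,Y)\tilde g(\tilde\varphi Z,W)\\ &+\eta(X)\eta(W)\,q(Y,Z)-\eta(X)\eta(Z)\,q(Y,W)+\eta(Y)\eta(Z)\,q(X,W)-\eta(Y)\eta(W)\,q(X,Z), \end{align*} where $q(U,V)=\bigl(\tilde\kappa+1-\tfrac{\tilde\mu}2\bigr)\tilde g(U,V)+(\tilde\mu-1)\tilde g(\tilde hU,V)$. In particular the curvature tensor is completely determined by $\tilde g$, $\tilde\varphi$, $\tilde h$, $\eta$, $\tilde\kappa$ and $\tilde\mu$. -/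

import Mathlib

open Bundle
open scoped Manifold ContDiff

namespace Paracontact

noncomputable section

section Fields

variable {E : Type*} [NormedAddCommGroup E] [NormedSpace ℝ E]
  {M : Type*} [TopologicalSpace M] [ChartedSpace E M]

/-- (Not necessarily smooth) vector fields on the manifold `M` modelled on `E`. -/
abbrev Field (E : Type*) [NormedAddCommGroup E] [NormedSpace ℝ E]
    (M : Type*) [TopologicalSpace M] [ChartedSpace E M] : Type _ :=
  (x : M) → TangentSpace 𝓘(ℝ, E) x

variable [IsManifold 𝓘(ℝ, E) ∞ M]

/-- `X` is a smooth vector field, i.e. `X ∈ Γ(TM)`. -/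
def IsSmooth (X : Field E M) : Prop :=
  ContMDiff 𝓘(ℝ, E) (𝓘(ℝ, E).prod 𝓘(ℝ, E)) ∞
    (fun x ↦ TotalSpace.mk' E (E := (TangentSpace 𝓘(ℝ, E) : M → Type _)) x (X x))

/-- The Lie bracket `[X, Y]` of vector fields. -/
abbrev bracket (X Y : Field E M) : Field E M :=
  VectorField.mlieBracket 𝓘(ℝ, E) X Y

/-- The derivative `X(f)` of a function along a vector field. -/
def dirDeriv (X : Field E M) (f : M → ℝ) : M → ℝ :=
  fun x ↦ mvfderiv 𝓘(ℝ, E) f x (X x)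

/-- The exterior derivative of a `1`-form, evaluated on two vector fields, with the normalization
`2 dη(X, Y) = X(η(Y)) - Y(η(X)) - η([X, Y])`. -/
def extDerivOneForm (η : (x : M) → TangentSpace 𝓘(ℝ, E) x →L[ℝ] ℝ) (X Y : Field E M) : M → ℝ :=
  fun x ↦ (1 / 2 : ℝ) *
    (dirDeriv X (fun y ↦ η y (Y y)) x - dirDeriv Y (fun y ↦ η y (X y)) x - η x (bracket X Y x))

end Fields

/-- A smooth pseudo-Riemannian metric on `M`: a smooth symmetric nondegenerate `(0,2)`-tensor
field. -/
structure PseudoRiemannianMetric (E : Type*) [NormedAddCommGroup E] [NormedSpace ℝ E]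
    (M : Type*) [TopologicalSpace M] [ChartedSpace E M] [IsManifold 𝓘(ℝ, E) ∞ M] where
  /-- The scalar product on each tangent space. -/
  val (x : M) : TangentSpace 𝓘(ℝ, E) x →L[ℝ] TangentSpace 𝓘(ℝ, E) x →L[ℝ] ℝ
  symm (x : M) (v w : TangentSpace 𝓘(ℝ, E) x) : val x v w = val x w v
  nondegenerate (x : M) (v : TangentSpace 𝓘(ℝ, E) x) : (∀ w, val x v w = 0) → v = 0
  contMDiff : ContMDiff 𝓘(ℝ, E) (𝓘(ℝ, E).prod 𝓘(ℝ, E →L[ℝ] E →L[ℝ] ℝ)) ∞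
    (fun x ↦ TotalSpace.mk' (E →L[ℝ] E →L[ℝ] ℝ) x (val x))

section Connection

variable {E : Type*} [NormedAddCommGroup E] [NormedSpace ℝ E]
  {M : Type*} [TopologicalSpace M] [ChartedSpace E M] [IsManifold 𝓘(ℝ, E) ∞ M]

/-- The connections on `TM`. For `D : Connection E M`, `D Y x (X x)` is `(∇_X Y)(x)`. -/
abbrev Connection (E : Type*) [NormedAddCommGroup E] [NormedSpace ℝ E]
    (M : Type*) [TopologicalSpace M] [ChartedSpace E M] [IsManifold 𝓘(ℝ, E) ∞ M] : Type _ :=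
  CovariantDerivative 𝓘(ℝ, E) E (TangentSpace 𝓘(ℝ, E) : M → Type _)

/-- The vector field `∇_X Y`. -/
def nabla (D : Connection E M) (X Y : Field E M) : Field E M :=
  fun x ↦ D Y x (X x)

/-- `D` is the Levi-Civita connection of `g`: it is a smooth connection that is torsion-free and
for which `g` is parallel. -/
structure IsLeviCivita (g : PseudoRiemannianMetric E M) (D : Connection E M) : Prop where
  smooth : CovariantDerivative.ContMDiffCovariantDerivative D ∞
  torsion_free : ∀ (X Y : Field E M) (x : M),
    MDifferentiableAt 𝓘(ℝ, E) (𝓘(ℝ, E).prod 𝓘(ℝ, E))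
      (fun y ↦ TotalSpace.mk' E (E := (TangentSpace 𝓘(ℝ, E) : M → Type _)) y (X y)) x →
    MDifferentiableAt 𝓘(ℝ, E) (𝓘(ℝ, E).prod 𝓘(ℝ, E))
      (fun y ↦ TotalSpace.mk' E (E := (TangentSpace 𝓘(ℝ, E) : M → Type _)) y (Y y)) x →
    nabla D X Y x - nabla D Y X x = bracket X Y x
  metric : ∀ (X Y Z : Field E M) (x : M),
    MDifferentiableAt 𝓘(ℝ, E) (𝓘(ℝ, E).prod 𝓘(ℝ, E))
      (fun y ↦ TotalSpace.mk' E (E := (TangentSpace 𝓘(ℝ, E) : M → Type _)) y (Y y)) x →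
    MDifferentiableAt 𝓘(ℝ, E) (𝓘(ℝ, E).prod 𝓘(ℝ, E))
      (fun y ↦ TotalSpace.mk' E (E := (TangentSpace 𝓘(ℝ, E) : M → Type _)) y (Z y)) x →
    dirDeriv X (fun y ↦ g.val y (Y y) (Z y)) x =
      g.val x (nabla D X Y x) (Z x) + g.val x (Y x) (nabla D X Z x)

/-- The curvature `R_{XY} Z = ∇_X ∇_Y Z - ∇_Y ∇_X Z - ∇_{[X,Y]} Z`. -/
def curvature (D : Connection E M) (X Y Z : Field E M) : Field E M :=
  fun x ↦ nabla D X (nabla D Y Z) x - nabla D Y (nabla D X Z) x - nabla D (bracket X Y) Z x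

end Connection

/-- A paracontact metric structure `(φ, ξ, η, g)` on the manifold `M` of dimension `2n+1`. -/
structure MetricStructure (n : ℕ) (E : Type*) [NormedAddCommGroup E] [NormedSpace ℝ E]
    (M : Type*) [TopologicalSpace M] [ChartedSpace E M] [IsManifold 𝓘(ℝ, E) ∞ M] where
  /-- The `(1,1)`-tensor field `φ`. -/
  φ (x : M) : TangentSpace 𝓘(ℝ, E) x →L[ℝ] TangentSpace 𝓘(ℝ, E) x
  /-- The vector field `ξ`. -/
  ξ : Field E M
  /-- The `1`-form `η`. -/
  η (x : M) : TangentSpace 𝓘(ℝ, E) x →L[ℝ] ℝ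
  /-- The pseudo-Riemannian metric. -/
  g : PseudoRiemannianMetric E M
  smooth_φ : ContMDiff 𝓘(ℝ, E) (𝓘(ℝ, E).prod 𝓘(ℝ, E →L[ℝ] E)) ∞
    (fun x ↦ TotalSpace.mk' (E →L[ℝ] E)
      (E := fun x : M ↦ TangentSpace 𝓘(ℝ, E) x →L[ℝ] TangentSpace 𝓘(ℝ, E) x) x (φ x))
  smooth_ξ : IsSmooth ξ
  smooth_η : ContMDiff 𝓘(ℝ, E) (𝓘(ℝ, E).prod 𝓘(ℝ, E →L[ℝ] ℝ)) ∞
    (fun x ↦ TotalSpace.mk' (E →L[ℝ] ℝ)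
      (E := fun x : M ↦ TangentSpace 𝓘(ℝ, E) x →L[ℝ] Bundle.Trivial M ℝ x) x (η x))
  η_ξ (x : M) : η x (ξ x) = 1
  φ_sq (x : M) (v : TangentSpace 𝓘(ℝ, E) x) : φ x (φ x v) = v - η x v • ξ x
  /-- The eigendistribution of `φ` for the eigenvalue `1` has rank `n`. -/
  finrank_pos (x : M) :
    Module.finrank ℝ (Module.End.eigenspace (φ x).toLinearMap (1 : ℝ)) = n
  /-- The eigendistribution of `φ` for the eigenvalue `-1` has rank `n`. -/
  finrank_neg (x : M) :
    Module.finrank ℝ (Module.End.eigenspace (φ x).toLinearMap (-1 : ℝ)) = n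
  compatible (x : M) (v w : TangentSpace 𝓘(ℝ, E) x) :
    g.val x (φ x v) (φ x w) = - g.val x v w + η x v * η x w
  /-- `dη(X, Y) = g(X, φY)` for all vector fields `X`, `Y`. -/
  contact (X Y : Field E M) (hX : IsSmooth X) (hY : IsSmooth Y) (x : M) :
    extDerivOneForm η X Y x = g.val x (X x) (φ x (Y x))

namespace MetricStructure

variable {n : ℕ} {E : Type*} [NormedAddCommGroup E] [NormedSpace ℝ E]
  {M : Type*} [TopologicalSpace M] [ChartedSpace E M] [IsManifold 𝓘(ℝ, E) ∞ M]

/-- The vector field `φX`. -/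
def phi (P : MetricStructure n E M) (X : Field E M) : Field E M :=
  fun x ↦ P.φ x (X x)

/-- The vector field `hX`, where `h = (1/2) L_ξ φ`, i.e. `2 hX = [ξ, φX] - φ[ξ, X]`. -/
def h (P : MetricStructure n E M) (X : Field E M) : Field E M :=
  fun x ↦ (1 / 2 : ℝ) • (bracket P.ξ (P.phi X) x - P.phi (bracket P.ξ X) x)

/-- The function `g(X, Y)`. -/
def ip (P : MetricStructure n E M) (X Y : Field E M) : M → ℝ :=
  fun x ↦ P.g.val x (X x) (Y x)

/-- The function `η(X)`. -/
def eta (P : MetricStructure n E M) (X : Field E M) : M → ℝ :=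
  fun x ↦ P.η x (X x)

/-- The `(κ, μ)`-nullity condition
`R_{XY} ξ = κ (η(Y) X - η(X) Y) + μ (η(Y) hX - η(X) hY)` for all vector fields `X`, `Y`. -/
def Nullity (P : MetricStructure n E M) (D : Connection E M) (κ μ : ℝ) : Prop :=
  ∀ X Y : Field E M, IsSmooth X → IsSmooth Y → ∀ x : M,
    curvature D X Y P.ξ x =
      κ • (P.eta Y x • X x - P.eta X x • Y x) + μ • (P.eta Y x • P.h X x - P.eta X x • P.h Y x)

/-- The value of `X` at `x` lies in the fibre at `x` of the eigendistribution `D_h(c)`. -/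
def InEigen (P : MetricStructure n E M) (c : ℝ) (X : Field E M) (x : M) : Prop :=
  P.h X x = c • X x

end MetricStructure

end

end Paracontact

/-! Everything rests on the endomorphism `S` = φh, the self-adjoint part of X ↦ ∇_X ξ = SX - φX. It
anticommutes with φ, and the nullity condition gives h² = (1+κ)φ². As κ > -1, the horizontal fields
(those killed by η) split into eigenfields of h for ±√(1+κ), and φ exchanges the two kinds.

In this splitting, the horizontal part of the nullity condition is a Codazzi equation for `S`.
Together with closedness of the fundamental form it forces the horizontal parts of ∇φ and ∇S to
vanish, so both derivatives are explicit (`cd_φ`, `cd_S`). The Ricci identity then gives the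
commutators of R_XY with φ and `S` (`g_R_φ`, `g_R_S`).

The right-hand side of (b), `modelR`, has the symmetries of a curvature tensor, the same values on ξ
and the same commutators. The difference is therefore a curvature-like tensor that annihilates ξ and
commutes with φ and `S`, and such a tensor is zero (`IsCurvatureLike.eq_zero`). Part (a) is (b)
evaluated on eigenvectors (`curvature_of_inEigen`).

The argument is carried out for a module over a commutative ring in which 2 is invertible. Smooth
fields over smooth functions are an instance (`toModule`), so no local frames are needed. -/

namespace Paracontact

/-! ### The algebraic model of a paracontact metric manifold. -/

/-- The algebraic data underlying a paracontact metric manifold with its Levi-Civita connection: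
`A` plays the role of the ring of functions and `V` that of the module of vector fields. -/
structure ParacontactModule (A V : Type*) [CommRing A] [AddCommGroup V] [Module A V] where
  /-- The derivative of a function along a vector field. -/
  der : V → A → A
  /-- The covariant derivative. -/
  nab : V → V → V
  /-- The metric. -/
  g : V →ₗ[A] V →ₗ[A] A
  /-- The structure endomorphism. -/
  φ : V →ₗ[A] V
  /-- The Reeb field. -/
  ξ : V
  der_add : ∀ X a b, der X (a + b) = der X a + der X b
  der_mul : ∀ X a b, der X (a * b) = a * der X b + der X a * b
  nab_add_left : ∀ X X' Y, nab (X + X') Y = nab X Y + nab X' Y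
  nab_smul_left : ∀ (a : A) X Y, nab (a • X) Y = a • nab X Y
  nab_add_right : ∀ X Y Y', nab X (Y + Y') = nab X Y + nab X Y'
  nab_smul_right : ∀ (a : A) X Y, nab X (a • Y) = der X a • Y + a • nab X Y
  der_comm : ∀ X Y a, der X (der Y a) - der Y (der X a) = der (nab X Y - nab Y X) a
  bianchi : ∀ X Y Z,
    (nab X (nab Y Z) - nab Y (nab X Z) - nab (nab X Y - nab Y X) Z)
    + (nab Y (nab Z X) - nab Z (nab Y X) - nab (nab Y Z - nab Z Y) X)
    + (nab Z (nab X Y) - nab X (nab Z Y) - nab (nab Z X - nab X Z) Y) = 0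
  g_comm : ∀ X Y, g X Y = g Y X
  g_nondeg : ∀ X, (∀ Y, g X Y = 0) → X = 0
  der_g : ∀ X Y Z, der X (g Y Z) = g (nab X Y) Z + g Y (nab X Z)
  g_ξ_ξ : g ξ ξ = 1
  φ_ξ : φ ξ = 0
  φ_φ : ∀ X, φ (φ X) = X - g X ξ • ξ
  g_φ : ∀ X Y, g X (φ Y) = - g (φ X) Y
  contact : ∀ X Y, g (nab X ξ) Y - g (nab Y ξ) X = 2 * g X (φ Y)

namespace ParacontactModule

set_option linter.unusedSectionVars false

variable {A V : Type*} [CommRing A] [AddCommGroup V] [Module A V]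
  (P : ParacontactModule A V)


/-! ### Covariant derivatives of endomorphisms and the curvature. -/

section Connection

lemma der_zero (X : V) : P.der X 0 = 0 := by
  have := P.der_add X 0 0
  simpa using this

lemma der_one (X : V) : P.der X 1 = 0 := by
  have := P.der_mul X 1 1
  simpa using this

lemma der_neg (X : V) (a : A) : P.der X (-a) = -P.der X a := by
  have := P.der_add X a (-a)
  rw [add_neg_cancel, P.der_zero] at this
  linear_combination -this

lemma der_sub (X : V) (a b : A) : P.der X (a - b) = P.der X a - P.der X b := by
  rw [sub_eq_add_neg, P.der_add, P.der_neg, sub_eq_add_neg]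

lemma der_two_mul (X : V) (a : A) : P.der X (2 * a) = 2 * P.der X a := by
  rw [two_mul, P.der_add, two_mul]

lemma nab_zero_right (X : V) : P.nab X 0 = 0 := by
  have := P.nab_add_right X 0 0
  simpa using this

lemma nab_neg_right (X Y : V) : P.nab X (-Y) = -P.nab X Y := by
  have := P.nab_add_right X Y (-Y)
  rw [add_neg_cancel, P.nab_zero_right] at this
  exact (neg_eq_of_add_eq_zero_right this.symm).symm

lemma nab_sub_right (X Y Z : V) : P.nab X (Y - Z) = P.nab X Y - P.nab X Z := by
  rw [sub_eq_add_neg, P.nab_add_right, P.nab_neg_right, sub_eq_add_neg]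

lemma nab_neg_left (X Y : V) : P.nab (-X) Y = -P.nab X Y := by
  rw [← neg_one_smul A X, P.nab_smul_left, neg_one_smul]

lemma nab_sub_left (X Y Z : V) : P.nab (X - Y) Z = P.nab X Z - P.nab Y Z := by
  rw [sub_eq_add_neg, P.nab_add_left, P.nab_neg_left, sub_eq_add_neg]


/-- Two fields with the same scalar products are equal. -/
lemma ext_g {X Y : V} (h : ∀ Z, P.g X Z = P.g Y Z) : X = Y := by
  rw [← sub_eq_zero]
  refine P.g_nondeg _ fun Z ↦ ?_
  rw [map_sub, LinearMap.sub_apply, h, sub_self]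

/-- The covariant derivative of an endomorphism field. -/
def cd (L : V →ₗ[A] V) : V →ₗ[A] V →ₗ[A] V :=
  LinearMap.mk₂ A (fun X Y ↦ P.nab X (L Y) - L (P.nab X Y))
    (fun X X' Y ↦ by simp only [P.nab_add_left, map_add]; abel)
    (fun a X Y ↦ by simp only [P.nab_smul_left, map_smul, smul_sub])
    (fun X Y Y' ↦ by simp only [P.nab_add_right, map_add]; abel)
    (fun a X Y ↦ by simp only [P.nab_smul_right, map_smul, map_add]; module)

lemma cd_apply (L : V →ₗ[A] V) (X Y : V) : P.cd L X Y = P.nab X (L Y) - L (P.nab X Y) := rfl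

lemma nab_apply (L : V →ₗ[A] V) (X Y : V) : P.nab X (L Y) = P.cd L X Y + L (P.nab X Y) := by
  rw [P.cd_apply]; abel

lemma cd_comp (L L' : V →ₗ[A] V) (X Y : V) :
    P.cd (L ∘ₗ L') X Y = P.cd L X (L' Y) + L (P.cd L' X Y) := by
  simp only [P.cd_apply, LinearMap.comp_apply, map_sub]; abel

lemma cd_add (L L' : V →ₗ[A] V) (X Y : V) :
    P.cd (L + L') X Y = P.cd L X Y + P.cd L' X Y := by
  simp only [P.cd_apply, LinearMap.add_apply, P.nab_add_right]; abel

lemma cd_sub (L L' : V →ₗ[A] V) (X Y : V) :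
    P.cd (L - L') X Y = P.cd L X Y - P.cd L' X Y := by
  simp only [P.cd_apply, LinearMap.sub_apply, P.nab_sub_right]; abel

lemma cd_neg (L : V →ₗ[A] V) (X Y : V) : P.cd (-L) X Y = -P.cd L X Y := by
  simp only [P.cd_apply, LinearMap.neg_apply, P.nab_neg_right]; abel

lemma cd_zero (X Y : V) : P.cd 0 X Y = 0 := by
  simp only [P.cd_apply, LinearMap.zero_apply, P.nab_zero_right]; abel

lemma cd_smul {a : A} (ha : ∀ X, P.der X a = 0) (L : V →ₗ[A] V) (X Y : V) :
    P.cd (a • L) X Y = a • P.cd L X Y := by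
  simp only [P.cd_apply, LinearMap.smul_apply, P.nab_smul_right, ha]; module

/-- The covariant derivative of a self-adjoint endomorphism field is self-adjoint. -/
lemma g_cd_of_symm {L : V →ₗ[A] V} (hL : ∀ X Y, P.g (L X) Y = P.g X (L Y)) (X Y Z : V) :
    P.g (P.cd L X Y) Z = P.g Y (P.cd L X Z) := by
  have h := congrArg (P.der X) (hL Y Z)
  simp only [P.der_g] at h
  simp only [P.cd_apply, map_sub, LinearMap.sub_apply]
  linear_combination h - hL (P.nab X Y) Z - hL Y (P.nab X Z)

/-- The covariant derivative of a skew-adjoint endomorphism field is skew-adjoint. -/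
lemma g_cd_of_skew {L : V →ₗ[A] V} (hL : ∀ X Y, P.g (L X) Y = -P.g X (L Y)) (X Y Z : V) :
    P.g (P.cd L X Y) Z = -P.g Y (P.cd L X Z) := by
  have h := congrArg (P.der X) (hL Y Z)
  simp only [P.der_g, P.der_neg] at h
  simp only [P.cd_apply, map_sub, LinearMap.sub_apply]
  linear_combination h - hL (P.nab X Y) Z - hL Y (P.nab X Z)

/-- The curvature. -/
def R (X Y Z : V) : V :=
  P.nab X (P.nab Y Z) - P.nab Y (P.nab X Z) - P.nab (P.nab X Y - P.nab Y X) Z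

lemma R_bianchi (X Y Z : V) : P.R X Y Z + P.R Y Z X + P.R Z X Y = 0 := P.bianchi X Y Z

lemma R_swap (X Y Z : V) : P.R X Y Z = -P.R Y X Z := by
  simp only [R, P.nab_sub_left]; abel

lemma R_add_left (X X' Y Z : V) : P.R (X + X') Y Z = P.R X Y Z + P.R X' Y Z := by
  simp only [R, P.nab_sub_left, P.nab_add_left, P.nab_add_right]; abel

lemma R_smul_left (a : A) (X Y Z : V) : P.R (a • X) Y Z = a • P.R X Y Z := by
  simp only [R, P.nab_sub_left, P.nab_add_left, P.nab_smul_right, P.nab_smul_left]; module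

/-- Second derivatives of the function g(Z, W) commute up to [X, Y]. Expanding this by metric
compatibility leaves exactly the two curvature terms. -/
lemma g_R_skew (X Y Z W : V) : P.g (P.R X Y Z) W = -P.g (P.R X Y W) Z := by
  have h := P.der_comm X Y (P.g Z W)
  simp only [P.der_g, P.der_add, P.nab_sub_left, map_sub, LinearMap.sub_apply] at h
  simp only [R, map_sub, LinearMap.sub_apply, P.nab_sub_left]
  rw [P.g_comm (P.nab X (P.nab Y W)), P.g_comm (P.nab Y (P.nab X W)),
    P.g_comm (P.nab (P.nab X Y) W), P.g_comm (P.nab (P.nab Y X) W)]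
  linear_combination h

/-- The Ricci identity for an endomorphism field. -/
lemma R_apply_sub (L : V →ₗ[A] V) (X Y Z : V) :
    P.R X Y (L Z) - L (P.R X Y Z) =
      (P.nab X (P.cd L Y Z) - P.cd L (P.nab X Y) Z - P.cd L Y (P.nab X Z))
      - (P.nab Y (P.cd L X Z) - P.cd L (P.nab Y X) Z - P.cd L X (P.nab Y Z)) := by
  simp only [R, P.cd_apply, map_sub, P.nab_sub_left, P.nab_sub_right]; abel

end Connection

/-! ### The derivative of the Reeb field and the tensors `S` and `H`. -/

section Reeb

variable [Invertible (2 : A)]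

lemma two_cancel {a b : A} (h : 2 * a = 2 * b) : a = b := by
  have h2 : ⅟(2 : A) * 2 = 1 := invOf_mul_self _
  linear_combination ⅟(2 : A) * h + (b - a) * h2

/-- The endomorphism field `X ↦ ∇_X ξ`. -/
def N : V →ₗ[A] V where
  toFun X := P.nab X P.ξ
  map_add' X Y := P.nab_add_left X Y P.ξ
  map_smul' a X := P.nab_smul_left a X P.ξ

lemma nab_ξ (X : V) : P.nab X P.ξ = P.N X := rfl

lemma R_ξ (X Y : V) : P.R X Y P.ξ = P.cd P.N X Y - P.cd P.N Y X := by
  simp only [R, P.cd_apply, P.nab_ξ, map_sub]; abel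

lemma der_eta (X Y : V) : P.der X (P.g Y P.ξ) = P.g (P.nab X Y) P.ξ + P.g Y (P.N X) :=
  P.der_g X Y P.ξ

lemma η_φ (X : V) : P.g (P.φ X) P.ξ = 0 := by
  have := P.g_φ X P.ξ
  rw [P.φ_ξ, map_zero] at this
  linear_combination this

lemma η_N (X : V) : P.g (P.N X) P.ξ = 0 := by
  have h := P.der_eta X P.ξ
  rw [P.g_ξ_ξ, P.der_one, P.nab_ξ, P.g_comm P.ξ] at h
  exact two_cancel (by linear_combination -h)

lemma N_ξ : P.N P.ξ = 0 := by
  refine P.g_nondeg _ fun Y ↦ ?_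
  have h := P.contact P.ξ Y
  rw [P.nab_ξ, P.nab_ξ, P.η_N, P.g_comm P.ξ, P.η_φ] at h
  linear_combination h

/-- The self-adjoint part of `X ↦ ∇_X ξ`. -/
def S : V →ₗ[A] V := P.N + P.φ

lemma N_eq : P.N = P.S - P.φ := by rw [S, add_sub_cancel_right]

lemma N_apply (X : V) : P.N X = P.S X - P.φ X := by rw [N_eq, LinearMap.sub_apply]

lemma S_ξ : P.S P.ξ = 0 := by
  rw [S, LinearMap.add_apply, P.N_ξ, P.φ_ξ, add_zero]

lemma η_S (X : V) : P.g (P.S X) P.ξ = 0 := by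
  rw [S, LinearMap.add_apply, map_add, LinearMap.add_apply, P.η_N, P.η_φ, add_zero]

/-- `contact` says that the skew part of `N` is -φ, so adding φ leaves the self-adjoint part. -/
lemma g_S (X Y : V) : P.g X (P.S Y) = P.g (P.S X) Y := by
  have h := P.contact X Y
  have h' := P.g_φ X Y
  simp only [P.nab_ξ] at h
  simp only [S, LinearMap.add_apply, map_add]
  rw [P.g_comm X (P.N Y)]
  linear_combination -h - h'

lemma φ_skew (X Y : V) : P.g (P.φ X) Y = -P.g X (P.φ Y) := by rw [P.g_φ, neg_neg]

/-- The fundamental `2`-form is closed. -/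
lemma fundamental_form_closed (X Y Z : V) :
    P.g (P.cd P.φ X Y) Z + P.g (P.cd P.φ Y Z) X + P.g (P.cd P.φ Z X) Y = 0 := by
  -- This is the derivative of the contact condition. Summed cyclically, the right-hand side is, up
  -- to sign, the cyclic sum of g(R_XY ξ, Z), which vanishes by the Bianchi identity paired with ξ.
  have key : ∀ X Y Z : V, 2 * P.g (P.cd P.φ X Y) Z =
      P.g (P.cd P.N X Z) Y - P.g (P.cd P.N X Y) Z := by
    intro X Y Z
    have h := congrArg (P.der X) (P.contact Z Y)
    have h₁ := P.contact (P.nab X Z) Y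
    have h₂ := P.contact Z (P.nab X Y)
    simp only [P.nab_ξ, P.der_sub, P.der_g, P.der_two_mul] at h h₁ h₂
    simp only [P.cd_apply, map_sub, LinearMap.sub_apply]
    rw [P.g_comm (P.nab X (P.φ Y)), P.g_comm (P.φ (P.nab X Y))]
    linear_combination h₁ + h₂ - h
  have hb := congrArg (fun W ↦ P.g W P.ξ) (P.R_bianchi X Y Z)
  simp only [map_add, LinearMap.add_apply, map_zero, LinearMap.zero_apply] at hb
  rw [P.g_R_skew X Y, P.g_R_skew Y Z, P.g_R_skew Z X] at hb
  simp only [P.R_ξ, map_sub, LinearMap.sub_apply] at hb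
  refine two_cancel ?_
  linear_combination key X Y Z + key Y Z X + key Z X Y + hb

lemma cd_φ_ξ (X : V) : P.cd P.φ X P.ξ = -P.φ (P.N X) := by
  rw [P.cd_apply, P.φ_ξ, P.nab_zero_right, P.nab_ξ, zero_sub]

lemma g_cd_φ (X Y Z : V) : P.g (P.cd P.φ X Y) Z = -P.g (P.cd P.φ X Z) Y := by
  rw [P.g_cd_of_skew P.φ_skew, P.g_comm Y]

/-- The derivative of φ² = I - η ⊗ ξ. -/
lemma cd_φ_φ (X Y : V) : P.cd P.φ X (P.φ Y) + P.φ (P.cd P.φ X Y) =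
    -(P.g Y (P.N X) • P.ξ) - P.g Y P.ξ • P.N X := by
  rw [← P.cd_comp, P.cd_apply]
  simp only [LinearMap.comp_apply, P.φ_φ, P.nab_sub_right, P.nab_smul_right, P.der_eta, P.nab_ξ]
  module

/-- Closedness of the fundamental form with one argument equal to ξ. The right-hand side is in fact
zero (`cd_ξ_φ`), but this form is what yields `S_φ`. -/
lemma cd_ξ_φ_aux (X : V) : P.cd P.φ P.ξ X = -P.φ (P.S X) - P.S (P.φ X) := by
  refine P.ext_g fun Y ↦ ?_
  have h := P.fundamental_form_closed P.ξ X Y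
  rw [P.g_cd_φ X Y, P.cd_φ_ξ, P.cd_φ_ξ] at h
  have h₁ := P.g_φ (P.φ X) Y
  have h₂ := P.g_comm (P.φ X) (P.φ Y)
  have h₃ := P.g_S (P.φ Y) X
  have h₄ := P.g_φ (P.S Y) X
  have h₅ := P.g_S (P.φ X) Y
  simp only [P.N_apply, map_sub, map_neg, LinearMap.sub_apply, LinearMap.neg_apply] at *
  rw [P.g_comm (P.φ (P.S Y))] at h
  have h₆ := P.g_comm (P.φ X) (P.S Y)
  have h₇ := P.g_comm X (P.φ (P.S Y))
  have h₈ := P.g_φ (P.φ Y) X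
  linear_combination h + h₁ - h₂ + h₄ - h₅ + h₆ + h₇ - h₈

/-- Since ∇_ξ ξ = 0, differentiating φ² along ξ shows that ∇_ξ φ = -(φS + Sφ) anticommutes with φ.
This reads 2(S + φSφ) = 0, and composing with φ gives the claim. -/
lemma S_φ (X : V) : P.S (P.φ X) = -P.φ (P.S X) := by
  have h := P.cd_φ_φ P.ξ X
  simp only [P.cd_ξ_φ_aux, P.N_ξ, P.φ_φ, map_sub, map_neg, map_smul, P.S_ξ, P.η_S, map_zero,
    smul_zero, zero_smul, sub_zero, neg_zero] at h
  have h₂ : P.S X = -P.φ (P.S (P.φ X)) := by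
    refine P.ext_g fun Z ↦ two_cancel ?_
    have := congrArg (fun W ↦ P.g W Z) h
    simp only [map_add, map_sub, map_neg, LinearMap.add_apply, LinearMap.sub_apply,
      LinearMap.neg_apply, map_zero, LinearMap.zero_apply] at this ⊢
    linear_combination -this
  rw [h₂, map_neg, P.φ_φ, P.η_S, zero_smul, sub_zero, neg_neg]

lemma cd_ξ_φ (X : V) : P.cd P.φ P.ξ X = 0 := by
  rw [P.cd_ξ_φ_aux, P.S_φ]; abel

/-- The tensor field `h`, as `φ ∘ S`. -/
def H : V →ₗ[A] V := P.φ ∘ₗ P.S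

lemma H_apply (X : V) : P.H X = P.φ (P.S X) := rfl

/-- `H` is half the Lie derivative of `φ` along the Reeb field. -/
lemma two_smul_H (X : V) : (2 : A) • P.H X =
    (P.nab P.ξ (P.φ X) - P.nab (P.φ X) P.ξ) - P.φ (P.nab P.ξ X - P.nab X P.ξ) := by
  rw [P.nab_apply, P.cd_ξ_φ]
  simp only [P.nab_ξ, P.N_apply, map_sub, P.S_φ, H_apply]
  module

lemma H_ξ : P.H P.ξ = 0 := by rw [H_apply, P.S_ξ, map_zero]

lemma η_H (X : V) : P.g (P.H X) P.ξ = 0 := P.η_φ _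

lemma φ_H (X : V) : P.φ (P.H X) = P.S X := by
  rw [H_apply, P.φ_φ, P.η_S, zero_smul, sub_zero]

lemma φ_S (X : V) : P.φ (P.S X) = P.H X := rfl

lemma S_φ' (X : V) : P.S (P.φ X) = -P.H X := P.S_φ X

lemma H_φ (X : V) : P.H (P.φ X) = -P.S X := by
  rw [H_apply, P.S_φ, map_neg, P.φ_S, P.φ_H]

lemma g_H (X Y : V) : P.g X (P.H Y) = P.g (P.H X) Y := by
  rw [H_apply, P.g_φ, P.g_S, P.S_φ', map_neg, LinearMap.neg_apply, neg_neg]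

lemma φ_φ_φ (X : V) : P.φ (P.φ (P.φ X)) = P.φ X := by
  rw [P.φ_φ, P.η_φ, zero_smul, sub_zero]

lemma φ_φ_S (X : V) : P.φ (P.φ (P.S X)) = P.S X := P.φ_H X

end Reeb

end ParacontactModule

end Paracontact

/-! ### The nullity condition and the derivatives of φ and `S`. -/

namespace Paracontact
namespace ParacontactModule

set_option linter.unusedSectionVars false

variable {A V : Type*} [CommRing A] [Invertible (2 : A)] [AddCommGroup V] [Module A V]
  (P : ParacontactModule A V)

section Nullity

/-- The `(κ, μ)`-nullity condition, for constants `κ`, `μ`. -/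
structure IsNullity (κ μ : A) : Prop where
  der_κ : ∀ X, P.der X κ = 0
  R_ξ : ∀ X Y, P.R X Y P.ξ = κ • (P.g Y P.ξ • X - P.g X P.ξ • Y)
    + μ • (P.g Y P.ξ • P.H X - P.g X P.ξ • P.H Y)

lemma cd_S_φ (X Y : V) : P.cd P.S X (P.φ Y) + P.S (P.cd P.φ X Y) + P.cd P.φ X (P.S Y)
    + P.φ (P.cd P.S X Y) = 0 := by
  have h : P.S ∘ₗ P.φ + P.φ ∘ₗ P.S = 0 := by
    ext X; simp [P.S_φ]
  have h' := congrArg (fun L ↦ P.cd L X Y) h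
  simp only [P.cd_add, P.cd_comp, P.cd_zero] at h'
  rw [← h']; abel

lemma g_cd_S (X Y Z : V) : P.g (P.cd P.S X Y) Z = P.g (P.cd P.S X Z) Y := by
  rw [P.g_cd_of_symm (fun X Y ↦ (P.g_S X Y).symm), P.g_comm Y]

variable {P} {κ μ : A} (hP : P.IsNullity κ μ)
include hP

/-- The nullity condition for R_ξX ξ, a Riccati equation for `S` along ξ. -/
lemma cd_ξ_S_add (X : V) : P.cd P.S P.ξ X + P.S (P.S X) + P.φ (P.φ X) =
    -(κ • P.φ (P.φ X)) - μ • P.H X := by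
  have h := hP.R_ξ P.ξ X
  rw [P.R_ξ, P.N_eq, P.cd_sub, P.cd_ξ_φ, ← P.N_eq, P.cd_apply P.N X, P.N_ξ, P.nab_zero_right,
    P.nab_ξ, P.g_ξ_ξ, P.H_ξ, P.N_apply (P.N X), P.N_apply, map_sub, map_sub, P.S_φ', P.φ_S] at h
  have h' : P.cd P.S P.ξ X + P.S (P.S X) + P.φ (P.φ X) =
      P.cd P.S P.ξ X - 0 - (0 - (P.S (P.S X) - -P.H X - (P.H X - P.φ (P.φ X)))) := by abel
  rw [h', h, P.φ_φ]; module

/-- Conjugation with φ splits the Riccati equation `cd_ξ_S_add`: S² and φ² commute with φ, while ∇_ξ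
S and `H` anticommute with it. The commuting part is this identity, the anticommuting part is
`cd_ξ_S`. -/
lemma S_S (X : V) : P.S (P.S X) = -((1 + κ) • P.φ (P.φ X)) := by
  have h₁ := cd_ξ_S_add hP X
  have h₂ := congrArg P.φ (cd_ξ_S_add hP (P.φ X))
  have h₃ := P.cd_S_φ P.ξ X
  rw [P.cd_ξ_φ, P.cd_ξ_φ, map_zero, add_zero, add_zero] at h₃
  have h₄ : P.g (P.cd P.S P.ξ X) P.ξ = 0 := by
    rw [P.g_cd_S, P.cd_apply, P.S_ξ, P.nab_zero_right, P.nab_ξ, P.N_ξ]; simp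
  have h₅ : P.φ (P.cd P.S P.ξ (P.φ X)) = -P.cd P.S P.ξ X := by
    rw [eq_neg_of_add_eq_zero_left h₃, map_neg, P.φ_φ, h₄, zero_smul, sub_zero]
  have h₆ : P.φ (P.S (P.S (P.φ X))) = P.S (P.S X) := by
    rw [P.S_φ, map_neg, P.S_φ, neg_neg, P.φ_φ_S]
  simp only [map_add, map_sub, map_neg, map_smul, h₅, h₆, P.φ_φ_φ, P.H_φ, P.φ_S] at h₂
  refine P.ext_g fun Z ↦ two_cancel ?_
  have e₁ := congrArg (fun W ↦ P.g W Z) h₁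
  have e₂ := congrArg (fun W ↦ P.g W Z) h₂
  simp only [map_add, map_sub, map_neg, map_smul, LinearMap.add_apply, LinearMap.sub_apply,
    LinearMap.neg_apply, LinearMap.smul_apply, smul_eq_mul] at e₁ e₂ ⊢
  linear_combination e₁ + e₂

lemma cd_ξ_S (X : V) : P.cd P.S P.ξ X = -(μ • P.H X) := by
  have h := cd_ξ_S_add hP X
  rw [S_S hP] at h
  have h' : P.cd P.S P.ξ X = (P.cd P.S P.ξ X + -((1 + κ) • P.φ (P.φ X)) + P.φ (P.φ X))
    + κ • P.φ (P.φ X) := by module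
  rw [h', h]; module

lemma S_H (X : V) : P.S (P.H X) = (1 + κ) • P.φ X := by
  rw [H_apply, P.S_φ, S_S hP, map_neg, map_smul, P.φ_φ_φ, neg_neg]

lemma H_H (X : V) : P.H (P.H X) = (1 + κ) • P.φ (P.φ X) := by
  rw [P.H_apply (P.H X), S_H hP, map_smul]

lemma horizontal_of_eigen {l l' : A} (hl : l' * l = 1) {X : V} (hX : P.H X = l • X) :
    P.g X P.ξ = 0 := by
  have h := P.η_H X
  rw [hX, map_smul, LinearMap.smul_apply, smul_eq_mul] at h
  linear_combination l' * h - P.g X P.ξ * hl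

/-- A linear form vanishes on horizontal fields if it does so on the eigenfields of `H` for `l` and
on their images under `φ`. -/
lemma linear_eq_zero {l l' : A} (hl : l' * l = 1) (hlκ : l * l = 1 + κ) (f : V →ₗ[A] A)
    (h₁ : ∀ X, P.H X = l • X → f X = 0) (h₂ : ∀ X, P.H X = l • X → f (P.φ X) = 0)
    {X : V} (hX : P.g X P.ξ = 0) : f X = 0 := by
  have hφφ : P.φ (P.φ X) = X := by rw [P.φ_φ, hX, zero_smul, sub_zero]
  -- For horizontal X, lX + HX and lX - HX are eigenfields for l and -l, and φ carries the second to
  -- an eigenfield for l. Their sum is 2lX, with 2 and l invertible.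
  have e₁ := h₁ (l • X + P.H X) (by
    rw [map_add, map_smul, H_H hP, hφφ, ← hlκ]; module)
  have e₂ := h₂ (P.φ (l • X - P.H X)) (by
    rw [P.H_φ]
    simp only [map_sub, map_smul, S_H hP, P.φ_H, ← hlκ]; module)
  simp only [P.φ_φ, map_add, map_sub, map_smul, P.η_H, hX, smul_eq_mul, zero_mul,
    sub_zero] at e₁ e₂
  refine two_cancel ?_
  linear_combination l' * (e₁ + e₂) - 2 * f X * hl

lemma trilinear_eq_zero {l l' : A} (hl : l' * l = 1) (hlκ : l * l = 1 + κ)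
    (f : V →ₗ[A] V →ₗ[A] V →ₗ[A] A)
    (h : ∀ X Y Z, P.H X = l • X → P.H Y = l • Y → P.H Z = l • Z →
      (f X Y Z = 0 ∧ f X Y (P.φ Z) = 0 ∧ f X (P.φ Y) Z = 0 ∧ f X (P.φ Y) (P.φ Z) = 0) ∧
      (f (P.φ X) Y Z = 0 ∧ f (P.φ X) Y (P.φ Z) = 0 ∧ f (P.φ X) (P.φ Y) Z = 0 ∧
        f (P.φ X) (P.φ Y) (P.φ Z) = 0))
    {X Y Z : V} (hX : P.g X P.ξ = 0) (hY : P.g Y P.ξ = 0) (hZ : P.g Z P.ξ = 0) :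
    f X Y Z = 0 := by
  refine linear_eq_zero hP hl hlκ ((f.flip Y).flip Z) (fun X' hX' ↦ ?_) (fun X' hX' ↦ ?_) hX <;>
  simp only [LinearMap.flip_apply] <;>
  refine linear_eq_zero hP hl hlκ ((f _).flip Z) (fun Y' hY' ↦ ?_) (fun Y' hY' ↦ ?_) hY <;>
  simp only [LinearMap.flip_apply] <;>
  refine linear_eq_zero hP hl hlκ (f _ _) (fun Z' hZ' ↦ ?_) (fun Z' hZ' ↦ ?_) hZ <;>
  [exact (h _ _ _ hX' hY' hZ').1.1; exact (h _ _ _ hX' hY' hZ').1.2.1;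
   exact (h _ _ _ hX' hY' hZ').1.2.2.1; exact (h _ _ _ hX' hY' hZ').1.2.2.2;
   exact (h _ _ _ hX' hY' hZ').2.1; exact (h _ _ _ hX' hY' hZ').2.2.1;
   exact (h _ _ _ hX' hY' hZ').2.2.2.1; exact (h _ _ _ hX' hY' hZ').2.2.2.2]

lemma g_cd_φ_φ (X : V) {Y Z : V} (hY : P.g Y P.ξ = 0) (hZ : P.g Z P.ξ = 0) :
    P.g (P.cd P.φ X (P.φ Y)) Z = P.g (P.cd P.φ X Y) (P.φ Z) := by
  have h := congrArg (fun W ↦ P.g W Z) (P.cd_φ_φ X Y)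
  simp only [map_add, map_sub, map_neg, map_smul, LinearMap.add_apply, LinearMap.sub_apply,
    LinearMap.neg_apply, LinearMap.smul_apply, smul_eq_mul, hY, P.g_comm P.ξ Z, hZ] at h
  linear_combination h - P.g_φ (P.cd P.φ X Y) Z

lemma g_cd_S_φ (X Y Z : V) : P.g (P.cd P.S X (P.φ Y)) Z + P.g (P.cd P.φ X Y) (P.S Z)
    + P.g (P.cd P.φ X (P.S Y)) Z - P.g (P.cd P.S X Y) (P.φ Z) = 0 := by
  have h := congrArg (fun W ↦ P.g W Z) (P.cd_S_φ X Y)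
  simp only [map_add, LinearMap.add_apply, map_zero, LinearMap.zero_apply] at h
  rw [P.g_S, P.g_φ]
  linear_combination h

lemma g_cd_S_S (X : V) {Y Z : V} (hY : P.g Y P.ξ = 0) (hZ : P.g Z P.ξ = 0) :
    P.g (P.cd P.S X (P.S Y)) Z + P.g (P.cd P.S X Y) (P.S Z) = 0 := by
  have e : P.S ∘ₗ P.S = (1 + κ) • -(P.φ ∘ₗ P.φ) := by
    ext X; simp [S_S hP]
  have h := congrArg (fun L ↦ P.g (P.cd L X Y) Z) e
  have h0 : ∀ X, P.der X (1 + κ) = 0 := fun X ↦ by rw [P.der_add, P.der_one, hP.der_κ, add_zero]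
  simp only [P.cd_smul h0, P.cd_neg, P.cd_comp, P.cd_φ_φ, map_add, map_sub, map_neg, map_smul,
    LinearMap.add_apply, LinearMap.sub_apply, LinearMap.neg_apply, LinearMap.smul_apply,
    smul_eq_mul, hY, P.g_comm P.ξ Z, hZ] at h
  rw [P.g_S]
  linear_combination h

/-- The Codazzi equation on horizontal fields. -/
lemma codazzi {X Y : V} (hX : P.g X P.ξ = 0) (hY : P.g Y P.ξ = 0) (Z : V) :
    P.g (P.cd P.S X Y) Z - P.g (P.cd P.S Y X) Z = -P.g (P.cd P.φ Z X) Y := by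
  have h := congrArg (fun W ↦ P.g W Z) (hP.R_ξ X Y)
  rw [P.R_ξ, P.N_eq] at h
  simp only [P.cd_sub, map_add, map_sub, map_smul, LinearMap.add_apply, LinearMap.sub_apply,
    LinearMap.smul_apply, smul_eq_mul, hX, hY] at h
  linear_combination h + P.fundamental_form_closed X Y Z - P.g_cd_φ Y X Z

/-- Differentiating the relations φ² = I - η ⊗ ξ, Sφ + φS = 0 and S² = -(1+κ)φ² expresses all
horizontal blocks of ∇_X φ and ∇_X S through three: g((∇_X φ)Y, Z), g((∇_X φ)Y, φZ) and g((∇_X S)Y,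
Z). -/
lemma cd_eigen (X : V) {l l' : A} (hl : l' * l = 1) {Y Z : V}
    (hY : P.H Y = l • Y) (hZ : P.H Z = l • Z) :
    P.g (P.cd P.φ X (P.φ Y)) Z = P.g (P.cd P.φ X Y) (P.φ Z) ∧
    P.g (P.cd P.φ X (P.φ Y)) (P.φ Z) = P.g (P.cd P.φ X Y) Z ∧
    P.g (P.cd P.S X Y) (P.φ Z) = l * P.g (P.cd P.φ X Y) (P.φ Z) ∧
    P.g (P.cd P.S X (P.φ Y)) Z = -(l * P.g (P.cd P.φ X Y) (P.φ Z)) ∧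
    P.g (P.cd P.S X (P.φ Y)) (P.φ Z) = P.g (P.cd P.S X Y) Z := by
  have hYξ := horizontal_of_eigen hP hl hY
  have hZξ := horizontal_of_eigen hP hl hZ
  have hφφ : P.φ (P.φ Z) = Z := by rw [P.φ_φ, hZξ, zero_smul, sub_zero]
  have hSY : P.S Y = l • P.φ Y := by rw [← P.φ_H, hY, map_smul]
  have hSZ : P.S Z = l • P.φ Z := by rw [← P.φ_H, hZ, map_smul]
  have hSφZ : P.S (P.φ Z) = -(l • Z) := by rw [P.S_φ', hZ]
  have a₁ := g_cd_φ_φ hP X hYξ hZξ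
  have a₂ := g_cd_φ_φ hP X hYξ (P.η_φ Z)
  have a₃ := g_cd_S_φ hP X Y Z
  have a₄ := g_cd_S_φ hP X Y (P.φ Z)
  have a₅ := g_cd_S_S hP X hYξ hZξ
  simp only [hφφ, hSY, hSZ, hSφZ, map_smul, map_neg, LinearMap.smul_apply,
    smul_eq_mul] at a₂ a₃ a₄ a₅
  have a₆ : P.g (P.cd P.S X (P.φ Y)) Z + P.g (P.cd P.S X Y) (P.φ Z) = 0 := by
    linear_combination l' * a₅ -
      (P.g (P.cd P.S X (P.φ Y)) Z + P.g (P.cd P.S X Y) (P.φ Z)) * hl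
  have a₇ : P.g (P.cd P.S X Y) (P.φ Z) = l * P.g (P.cd P.φ X Y) (P.φ Z) :=
    two_cancel (by linear_combination a₆ - a₃ + l * a₁)
  refine ⟨a₁, a₂, a₇, by linear_combination a₆ - a₇, ?_⟩
  linear_combination a₄ - l * a₂

/-- The Codazzi equation is evaluated on eigenfields for l and their φ-images. It makes g((∇_X φ)Y,
φZ), and likewise g((∇_φX φ)Y, φZ), symmetric in Y and Z. By `v_skew` both are also skew, hence
zero, and the other blocks follow. -/
lemma cd_eigen_eq_zero {l l' : A} (hl : l' * l = 1) {X Y Z : V}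
    (hX : P.H X = l • X) (hY : P.H Y = l • Y) (hZ : P.H Z = l • Z) :
    (P.g (P.cd P.φ X Y) (P.φ Z) = 0 ∧ P.g (P.cd P.φ (P.φ X) Y) Z = 0 ∧
      P.g (P.cd P.S (P.φ X) Y) Z = 0) ∧
    (P.g (P.cd P.φ (P.φ X) Y) (P.φ Z) = 0 ∧ P.g (P.cd P.φ X Y) Z = 0 ∧
      P.g (P.cd P.S X Y) Z = 0) := by
  have hor : ∀ {X}, P.H X = l • X → P.g X P.ξ = 0 := fun h ↦ horizontal_of_eigen hP hl h
  have v_skew : ∀ {X Y Z}, P.H Y = l • Y → P.H Z = l • Z →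
      P.g (P.cd P.φ X Y) (P.φ Z) = -P.g (P.cd P.φ X Z) (P.φ Y) := by
    intro X Y Z hY hZ
    rw [← (cd_eigen hP X hl hY hZ).1, P.g_cd_φ]
  have e₃ : ∀ {X Y Z}, P.H X = l • X → P.H Y = l • Y → P.H Z = l • Z →
      P.g (P.cd P.S (P.φ Y) X) Z =
        P.g (P.cd P.φ Z X) (P.φ Y) - l * P.g (P.cd P.φ X Y) (P.φ Z) := by
    intro X Y Z hX hY hZ
    have h := codazzi hP (hor hX) (P.η_φ Y) Z
    rw [(cd_eigen hP X hl hY hZ).2.2.2.1] at h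
    linear_combination -h
  have e₂ : ∀ {X Y Z}, P.H X = l • X → P.H Y = l • Y → P.H Z = l • Z →
      l * P.g (P.cd P.φ X Y) (P.φ Z) - l * P.g (P.cd P.φ Y X) (P.φ Z) =
        -P.g (P.cd P.φ (P.φ Z) X) Y := by
    intro X Y Z hX hY hZ
    rw [← codazzi hP (hor hX) (hor hY) (P.φ Z), (cd_eigen hP X hl hY hZ).2.2.1,
      (cd_eigen hP Y hl hX hZ).2.2.1]
  have e₄ : ∀ {X Y Z}, P.H X = l • X → P.H Y = l • Y → P.H Z = l • Z →
      P.g (P.cd P.S X Y) Z = l * P.g (P.cd P.φ (P.φ Y) X) (P.φ Z)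
        - P.g (P.cd P.φ (P.φ Z) X) (P.φ Y) := by
    intro X Y Z hX hY hZ
    have h := codazzi hP (hor hX) (P.η_φ Y) (P.φ Z)
    rw [(cd_eigen hP X hl hY hZ).2.2.2.2, (cd_eigen hP (P.φ Y) hl hX hZ).2.2.1] at h
    linear_combination h
  have e₅ : ∀ {X Y Z}, P.H X = l • X → P.H Y = l • Y → P.H Z = l • Z →
      l * P.g (P.cd P.φ (P.φ X) Y) (P.φ Z) - l * P.g (P.cd P.φ (P.φ Y) X) (P.φ Z) =
        P.g (P.cd P.φ Z X) Y := by
    intro X Y Z hX hY hZ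
    have h := codazzi hP (P.η_φ X) (P.η_φ Y) Z
    rw [(cd_eigen hP (P.φ X) hl hY hZ).2.2.2.1, (cd_eigen hP (P.φ Y) hl hX hZ).2.2.2.1,
      (cd_eigen hP Z hl hX hY).2.1] at h
    linear_combination -h
  have v : ∀ {X Y Z}, P.H X = l • X → P.H Y = l • Y → P.H Z = l • Z →
      P.g (P.cd P.φ X Y) (P.φ Z) = 0 := by
    intro Z X Y hZ hX hY
    have h := codazzi hP (P.η_φ X) (P.η_φ Y) (P.φ Z)
    rw [(cd_eigen hP (P.φ X) hl hY hZ).2.2.2.2, (cd_eigen hP (P.φ Y) hl hX hZ).2.2.2.2,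
      (cd_eigen hP (P.φ Z) hl hX hY).2.1] at h
    refine two_cancel ?_
    -- The terms with a factor `l` cancel by `e₂`. What remains is the symmetry in the last two
    -- eigenfields.
    linear_combination -h + e₃ hY hX hZ - e₃ hX hY hZ + e₂ hX hY hZ
      + v_skew (X := Z) hX hY
  have v' : ∀ {X Y Z}, P.H X = l • X → P.H Y = l • Y → P.H Z = l • Z →
      P.g (P.cd P.φ (P.φ X) Y) (P.φ Z) = 0 := by
    intro Z X Y hZ hX hY
    have h := codazzi hP (hor hX) (hor hY) Z
    refine two_cancel ?_
    linear_combination -h + e₄ hX hY hZ - e₄ hY hX hZ - e₅ hX hY hZ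
      + v_skew (X := P.φ Z) hX hY
  refine ⟨⟨v hX hY hZ, ?_, ?_⟩, v' hX hY hZ, ?_, ?_⟩
  · linear_combination e₂ hY hZ hX - l * v hY hZ hX + l * v hZ hY hX
  · linear_combination e₃ hY hX hZ + v hZ hY hX - l * v hY hX hZ
  · linear_combination -e₅ hY hZ hX + l * v' hY hZ hX - l * v' hZ hY hX
  · linear_combination e₄ hX hY hZ + l * v' hY hX hZ - v' hZ hX hY

variable {l l' : A} (hl : l' * l = 1) (hlκ : l * l = 1 + κ)
include hl hlκ

lemma g_cd_φ_horizontal {X Y Z : V} (hX : P.g X P.ξ = 0) (hY : P.g Y P.ξ = 0)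
    (hZ : P.g Z P.ξ = 0) : P.g (P.cd P.φ X Y) Z = 0 := by
  refine trilinear_eq_zero hP hl hlκ ((P.cd P.φ).compr₂ P.g) (fun X Y Z hX hY hZ ↦ ?_) hX hY hZ
  simp only [LinearMap.compr₂_apply]
  obtain ⟨⟨a₁, a₂, -⟩, a₃, a₄, -⟩ := cd_eigen_eq_zero hP hl hX hY hZ
  have b := cd_eigen hP X hl hY hZ
  have c := cd_eigen hP (P.φ X) hl hY hZ
  rw [b.1, b.2.1, c.1, c.2.1]
  exact ⟨⟨a₄, a₁, a₁, a₄⟩, a₂, a₃, a₃, a₂⟩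

lemma g_cd_S_horizontal {X Y Z : V} (hX : P.g X P.ξ = 0) (hY : P.g Y P.ξ = 0)
    (hZ : P.g Z P.ξ = 0) : P.g (P.cd P.S X Y) Z = 0 := by
  refine trilinear_eq_zero hP hl hlκ ((P.cd P.S).compr₂ P.g) (fun X Y Z hX hY hZ ↦ ?_) hX hY hZ
  simp only [LinearMap.compr₂_apply]
  obtain ⟨⟨a₁, -, a₂⟩, a₃, -, a₄⟩ := cd_eigen_eq_zero hP hl hX hY hZ
  have b := (cd_eigen hP X hl hY hZ).2.2
  have c := (cd_eigen hP (P.φ X) hl hY hZ).2.2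
  rw [b.1, b.2.1, b.2.2, c.1, c.2.1, c.2.2, a₁, a₂, a₃, a₄]
  simp

/-- The covariant derivative of `φ`. -/
lemma cd_φ (X Y : V) : P.cd P.φ X Y =
    P.g Y P.ξ • (P.φ (P.φ X) - P.H X) - P.g (P.φ (P.φ X) - P.H X) Y • P.ξ := by
  refine P.ext_g fun Z ↦ ?_
  have hη : ∀ X, P.g (X - P.g X P.ξ • P.ξ) P.ξ = 0 := fun X ↦ by simp [P.g_ξ_ξ]
  -- Only the ξ-components remain. They are fixed by ∇_ξ φ = 0, (∇_X φ)ξ = -φ(∇_X ξ) and skewness.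
  have h := g_cd_φ_horizontal hP hl hlκ (hη X) (hη Y) (hη Z)
  have hξ : ∀ X Y, P.g (P.cd P.φ X Y) P.ξ = P.g (P.φ (P.N X)) Y := fun X Y ↦ by
    rw [P.g_cd_φ, P.cd_φ_ξ]; simp
  simp only [map_sub, map_smul, LinearMap.sub_apply, LinearMap.smul_apply, smul_eq_mul,
    P.cd_ξ_φ, hξ, P.cd_φ_ξ, P.N_apply, P.φ_S, map_neg, LinearMap.neg_apply,
    map_zero, LinearMap.zero_apply, P.η_H, P.η_φ] at h ⊢
  rw [P.g_comm P.ξ Z]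
  linear_combination h

/-- The covariant derivative of `S`. -/
lemma cd_S (X Y : V) : P.cd P.S X Y =
    -(P.g Y P.ξ • (P.H X - (1 + κ) • P.φ (P.φ X))) - (μ * P.g X P.ξ) • P.H Y
      - P.g (P.H X - (1 + κ) • P.φ (P.φ X)) Y • P.ξ := by
  refine P.ext_g fun Z ↦ ?_
  have hη : ∀ X, P.g (X - P.g X P.ξ • P.ξ) P.ξ = 0 := fun X ↦ by simp [P.g_ξ_ξ]
  have h := g_cd_S_horizontal hP hl hlκ (hη X) (hη Y) (hη Z)
  have hS : ∀ X, P.cd P.S X P.ξ = -P.S (P.N X) := fun X ↦ by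
    rw [P.cd_apply, P.S_ξ, P.nab_zero_right, P.nab_ξ, zero_sub]
  have hξ : ∀ X Y, P.g (P.cd P.S X Y) P.ξ = -P.g (P.S (P.N X)) Y := fun X Y ↦ by
    rw [P.g_cd_S, hS]; simp
  simp only [map_sub, map_smul, LinearMap.sub_apply, LinearMap.smul_apply, smul_eq_mul,
    cd_ξ_S hP, hξ, hS, P.N_apply, S_S hP, P.S_φ', map_neg, LinearMap.neg_apply,
    map_zero, LinearMap.zero_apply, P.η_H, P.H_ξ, P.η_φ] at h ⊢
  rw [P.g_comm P.ξ Z]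
  linear_combination h

end Nullity

end ParacontactModule
end Paracontact

/-! ### Curvature-like tensors and the curvature formula. -/

namespace Paracontact
namespace ParacontactModule

set_option linter.unusedSectionVars false

variable {A V : Type*} [CommRing A] [Invertible (2 : A)] [AddCommGroup V] [Module A V]

/-- The algebraic symmetries of a `(0,4)` curvature tensor. -/
structure IsCurvatureLike (D : V → V → V → V → A) : Prop where
  add : ∀ X X' Y Z W, D (X + X') Y Z W = D X Y Z W + D X' Y Z W
  smul : ∀ (a : A) X Y Z W, D (a • X) Y Z W = a * D X Y Z W
  swap : ∀ X Y Z W, D X Y Z W = -D Y X Z W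
  swap' : ∀ X Y Z W, D X Y Z W = -D X Y W Z
  bianchi : ∀ X Y Z W, D X Y Z W + D Y Z X W + D Z X Y W = 0

namespace IsCurvatureLike

variable {D D' : V → V → V → V → A}

lemma sub (hD : IsCurvatureLike D) (hD' : IsCurvatureLike D') :
    IsCurvatureLike (fun X Y Z W ↦ D X Y Z W - D' X Y Z W) where
  add X X' Y Z W := by rw [hD.add, hD'.add]; ring
  smul a X Y Z W := by rw [hD.smul, hD'.smul]; ring
  swap X Y Z W := by rw [hD.swap, hD'.swap]; ring
  swap' X Y Z W := by rw [hD.swap', hD'.swap']; ring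
  bianchi X Y Z W := by linear_combination hD.bianchi X Y Z W - hD'.bianchi X Y Z W

lemma pair_symm (hD : IsCurvatureLike D) (X Y Z W : V) : D X Y Z W = D Z W X Y := by
  refine two_cancel ?_
  linear_combination hD.bianchi X Y Z W + hD.bianchi Y Z W X - hD.bianchi Z W X Y
    - hD.bianchi W X Y Z - hD.swap' Y Z W X - hD.swap' Z W Y X + hD.swap' W X Y Z
    + hD.swap' X Y W Z + hD.swap' X Z W Y + hD.swap Y W X Z - hD.swap' W Y X Z - hD.swap X Z Y W

/-- A curvature-like tensor as a linear form in its first argument. -/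
def toLinear (hD : IsCurvatureLike D) (Y Z W : V) : V →ₗ[A] A where
  toFun X := D X Y Z W
  map_add' X X' := hD.add X X' Y Z W
  map_smul' a X := hD.smul a X Y Z W

lemma toLinear_apply (hD : IsCurvatureLike D) (X Y Z W : V) :
    hD.toLinear Y Z W X = D X Y Z W := rfl

end IsCurvatureLike

variable (P : ParacontactModule A V)

lemma isCurvatureLike_R : IsCurvatureLike (fun X Y Z W ↦ P.g (P.R X Y Z) W) where
  add X X' Y Z W := by rw [P.R_add_left, map_add, LinearMap.add_apply]
  smul a X Y Z W := by rw [P.R_smul_left, map_smul, LinearMap.smul_apply, smul_eq_mul]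
  swap X Y Z W := by rw [P.R_swap, map_neg, LinearMap.neg_apply]
  swap' X Y Z W := P.g_R_skew X Y Z W
  bianchi X Y Z W := by
    have h := congrArg (fun U ↦ P.g U W) (P.R_bianchi X Y Z)
    simpa only [map_add, LinearMap.add_apply, map_zero, LinearMap.zero_apply] using h

lemma g_φ_swap (X Y : V) : P.g (P.φ X) Y = -P.g (P.φ Y) X := by
  rw [P.φ_skew, P.g_comm]

lemma g_H_swap (X Y : V) : P.g (P.H X) Y = P.g (P.H Y) X := by
  rw [← P.g_H, P.g_comm]

lemma g_S_swap (X Y : V) : P.g (P.S X) Y = P.g (P.S Y) X := by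
  rw [← P.g_S, P.g_comm]

/-- The curvature tensor of a paracontact `(κ, 2m)`-module, where `c` is the inverse of `κ + 1`. -/
def modelR (κ m c : A) (X Y Z W : V) : A :=
  (-1 + m) * (P.g Y Z * P.g X W - P.g X Z * P.g Y W)
  + P.g Y Z * P.g (P.H X) W - P.g X Z * P.g (P.H Y) W
  - P.g Y W * P.g (P.H X) Z + P.g X W * P.g (P.H Y) Z
  + (-1 + m) * c * (P.g (P.H Y) Z * P.g (P.H X) W - P.g (P.H X) Z * P.g (P.H Y) W)
  - m * (P.g (P.φ Y) Z * P.g (P.φ X) W - P.g (P.φ X) Z * P.g (P.φ Y) W)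
  + (-κ - m) * c * (P.g (P.S Y) Z * P.g (P.S X) W - P.g (P.S Y) W * P.g (P.S X) Z)
  + 2 * m * P.g (P.φ X) Y * P.g (P.φ Z) W
  + P.g X P.ξ * P.g W P.ξ * ((κ + 1 - m) * P.g Y Z + (2 * m - 1) * P.g (P.H Y) Z)
  - P.g X P.ξ * P.g Z P.ξ * ((κ + 1 - m) * P.g Y W + (2 * m - 1) * P.g (P.H Y) W)
  + P.g Y P.ξ * P.g Z P.ξ * ((κ + 1 - m) * P.g X W + (2 * m - 1) * P.g (P.H X) W)
  - P.g Y P.ξ * P.g W P.ξ * ((κ + 1 - m) * P.g X Z + (2 * m - 1) * P.g (P.H X) Z)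

lemma isCurvatureLike_modelR (κ m c : A) : IsCurvatureLike (P.modelR κ m c) where
  add X X' Y Z W := by simp only [modelR, map_add, LinearMap.add_apply]; ring
  smul a X Y Z W := by simp only [modelR, map_smul, LinearMap.smul_apply, smul_eq_mul]; ring
  swap X Y Z W := by simp only [modelR]; rw [P.g_φ_swap Y X]; ring
  swap' X Y Z W := by simp only [modelR]; rw [P.g_φ_swap W Z]; ring
  bianchi X Y Z W := by
    simp only [modelR]
    rw [P.g_φ_swap Z Y, P.g_φ_swap Y X, P.g_φ_swap Z X, P.g_H_swap Z Y, P.g_H_swap Y X,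
      P.g_H_swap Z X, P.g_S_swap Z Y, P.g_S_swap Y X, P.g_S_swap Z X, P.g_comm Z Y, P.g_comm Y X,
      P.g_comm Z X]
    ring

section Nullity

variable {P} {κ m : A} (hP : P.IsNullity κ (2 * m))
include hP

/-- As φ is skew and `S` self-adjoint, `hφ` and `hS` say that the endomorphism D(X, Y) commutes with
both on horizontal fields. It then preserves the eigendistributions of `H`, so entries whose last
two arguments lie in different ones vanish (`mixed`). The Bianchi identity kills the entries pairing
one distribution with the other (`opp`), and commutation with φ identifies the remaining ones with
these up to sign (`neg`). -/
lemma eq_zero_of_eigen {l l' : A} (hl : l' * l = 1)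
    {D : V → V → V → V → A} (hD : IsCurvatureLike D)
    (hφ : ∀ X Y Z W, P.g X P.ξ = 0 → P.g Y P.ξ = 0 → P.g Z P.ξ = 0 → P.g W P.ξ = 0 →
      D X Y (P.φ Z) W + D X Y Z (P.φ W) = 0)
    (hS : ∀ X Y Z W, P.g X P.ξ = 0 → P.g Y P.ξ = 0 → P.g Z P.ξ = 0 → P.g W P.ξ = 0 →
      D X Y (P.S Z) W - D X Y Z (P.S W) = 0)
    {X Y Z W : V} (hX : P.H X = l • X ∨ ∃ X', P.H X' = l • X' ∧ X = P.φ X')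
    (hY : P.H Y = l • Y ∨ ∃ Y', P.H Y' = l • Y' ∧ Y = P.φ Y')
    (hZ : P.H Z = l • Z ∨ ∃ Z', P.H Z' = l • Z' ∧ Z = P.φ Z')
    (hW : P.H W = l • W ∨ ∃ W', P.H W' = l • W' ∧ W = P.φ W') : D X Y Z W = 0 := by
  have hor : ∀ {X}, P.H X = l • X → P.g X P.ξ = 0 := fun h ↦ horizontal_of_eigen hP hl h
  have hφφ : ∀ {X}, P.H X = l • X → P.φ (P.φ X) = X := fun h ↦ by
    rw [P.φ_φ, hor h, zero_smul, sub_zero]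
  have hSl : ∀ {X}, P.H X = l • X → P.S X = l • P.φ X := fun h ↦ by
    rw [← P.φ_H, h, map_smul]
  have smul₃ : ∀ (a : A) X Y Z W, D X Y (a • Z) W = a * D X Y Z W := fun a X Y Z W ↦ by
    rw [hD.pair_symm, hD.smul, hD.pair_symm]
  have smul₄ : ∀ (a : A) X Y Z W, D X Y Z (a • W) = a * D X Y Z W := fun a X Y Z W ↦ by
    rw [hD.swap', smul₃, hD.swap' X Y Z W]; ring
  have mixed : ∀ {X Y Z W}, P.g X P.ξ = 0 → P.g Y P.ξ = 0 → P.H Z = l • Z → P.H W = l • W →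
      D X Y Z (P.φ W) = 0 := by
    intro X Y Z W hX hY hZ hW
    have h₁ := hφ X Y Z W hX hY (hor hZ) (hor hW)
    have h₂ := hS X Y Z W hX hY (hor hZ) (hor hW)
    rw [hSl hZ, hSl hW, smul₃, smul₄] at h₂
    refine two_cancel ?_
    linear_combination h₁ - l' * h₂
      + (D X Y (P.φ Z) W - D X Y Z (P.φ W)) * hl
  have mixed' : ∀ {X Y Z W}, P.g X P.ξ = 0 → P.g Y P.ξ = 0 → P.H Z = l • Z → P.H W = l • W →
      D X Y (P.φ Z) W = 0 := by
    intro X Y Z W hX hY hZ hW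
    rw [hD.swap', mixed hX hY hW hZ, neg_zero]
  have opp : ∀ {X Y Z W}, P.H X = l • X → P.H Y = l • Y → P.H Z = l • Z → P.H W = l • W →
      D X Y (P.φ Z) (P.φ W) = 0 := by
    intro X Y Z W hX hY hZ hW
    have h := hD.bianchi X Y (P.φ Z) (P.φ W)
    rw [mixed (hor hY) (P.η_φ Z) hX hW, mixed (P.η_φ Z) (hor hX) hY hW] at h
    linear_combination h
  have neg : ∀ {X Y Z W}, P.g X P.ξ = 0 → P.g Y P.ξ = 0 → P.H Z = l • Z → P.H W = l • W →
      D X Y (P.φ Z) (P.φ W) = -D X Y Z W := by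
    intro X Y Z W hX hY hZ hW
    have h := hφ X Y Z (P.φ W) hX hY (hor hZ) (P.η_φ W)
    rw [hφφ hW] at h
    linear_combination h
  obtain hX | ⟨X, hX, rfl⟩ := hX <;> obtain hY | ⟨Y, hY, rfl⟩ := hY
  · obtain hZ | ⟨Z, hZ, rfl⟩ := hZ <;> obtain hW | ⟨W, hW, rfl⟩ := hW
    · rw [← neg_eq_zero, ← neg (hor hX) (hor hY) hZ hW, opp hX hY hZ hW]
    · exact mixed (hor hX) (hor hY) hZ hW
    · exact mixed' (hor hX) (hor hY) hZ hW
    · exact opp hX hY hZ hW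
  · rw [hD.pair_symm]
    refine mixed ?_ ?_ hX hY
    · obtain hZ | ⟨Z, hZ, rfl⟩ := hZ
      exacts [hor hZ, P.η_φ Z]
    · obtain hW | ⟨W, hW, rfl⟩ := hW
      exacts [hor hW, P.η_φ W]
  · rw [hD.pair_symm]
    refine mixed' ?_ ?_ hX hY
    · obtain hZ | ⟨Z, hZ, rfl⟩ := hZ
      exacts [hor hZ, P.η_φ Z]
    · obtain hW | ⟨W, hW, rfl⟩ := hW
      exacts [hor hW, P.η_φ W]
  · obtain hZ | ⟨Z, hZ, rfl⟩ := hZ <;> obtain hW | ⟨W, hW, rfl⟩ := hW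
    · rw [hD.pair_symm, opp hZ hW hX hY]
    · exact mixed (P.η_φ X) (P.η_φ Y) hZ hW
    · exact mixed' (P.η_φ X) (P.η_φ Y) hZ hW
    · rw [neg (P.η_φ X) (P.η_φ Y) hZ hW, hD.pair_symm, opp hZ hW hX hY, neg_zero]

/-- A curvature-like tensor which annihilates `ξ` and commutes with `φ` and `S` vanishes. -/
lemma IsCurvatureLike.eq_zero {l l' : A} (hl : l' * l = 1) (hlκ : l * l = 1 + κ)
    {D : V → V → V → V → A} (hD : IsCurvatureLike D)
    (hξ : ∀ X Y Z, D X Y P.ξ Z = 0)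
    (hφ : ∀ X Y Z W, P.g X P.ξ = 0 → P.g Y P.ξ = 0 → P.g Z P.ξ = 0 → P.g W P.ξ = 0 →
      D X Y (P.φ Z) W + D X Y Z (P.φ W) = 0)
    (hS : ∀ X Y Z W, P.g X P.ξ = 0 → P.g Y P.ξ = 0 → P.g Z P.ξ = 0 → P.g W P.ξ = 0 →
      D X Y (P.S Z) W - D X Y Z (P.S W) = 0) (X Y Z W : V) : D X Y Z W = 0 := by
  let e (X : V) : Prop := P.H X = l • X ∨ ∃ X', P.H X' = l • X' ∧ X = P.φ X'
  have slot : ∀ Y Z W, (∀ X, e X → D X Y Z W = 0) → ∀ X, D X Y Z W = 0 := by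
    intro Y Z W h X
    have hX : P.g (X - P.g X P.ξ • P.ξ) P.ξ = 0 := by simp [P.g_ξ_ξ]
    have h₁ : hD.toLinear Y Z W (X - P.g X P.ξ • P.ξ) = 0 :=
      linear_eq_zero hP hl hlκ _ (fun X hX ↦ h X (.inl hX)) (fun X hX ↦ h _ (.inr ⟨X, hX, rfl⟩)) hX
    have h₂ : hD.toLinear Y Z W P.ξ = 0 := by
      rw [hD.toLinear_apply, hD.pair_symm, hξ]
    rw [map_sub, map_smul, h₂, smul_zero, sub_zero] at h₁
    exact h₁
  -- Skewness and pair symmetry bring each argument in turn to the first slot, so the arguments end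
  -- up reversed.
  refine slot _ _ _ (fun X hX ↦ ?_) X
  rw [hD.swap, neg_eq_zero]
  refine slot _ _ _ (fun Y hY ↦ ?_) Y
  rw [hD.pair_symm]
  refine slot _ _ _ (fun Z hZ ↦ ?_) Z
  rw [hD.swap, neg_eq_zero]
  refine slot _ _ _ (fun W hW ↦ ?_) W
  exact eq_zero_of_eigen hP hl hD hφ hS hW hZ hY hX

variable {l l' : A} (hl : l' * l = 1) (hlκ : l * l = 1 + κ)
include hl hlκ

/-- Since φ is skew, the left-hand side pairs [R_XY, φ]Z with W. In the Ricci identity with `cd_φ`,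
for horizontal Z and W, only the terms where a derivative meets η or ξ survive. -/
lemma g_R_φ (X Y : V) {Z W : V} (hZ : P.g Z P.ξ = 0) (hW : P.g W P.ξ = 0) :
    P.g (P.R X Y (P.φ Z)) W + P.g (P.R X Y Z) (P.φ W) =
      (P.g Z (P.N X) * P.g (P.φ (P.φ Y) - P.H Y) W - P.g (P.φ (P.φ Y) - P.H Y) Z * P.g (P.N X) W)
      - (P.g Z (P.N Y) * P.g (P.φ (P.φ X) - P.H X) W
        - P.g (P.φ (P.φ X) - P.H X) Z * P.g (P.N Y) W) := by
  have h := congrArg (fun U ↦ P.g U W) (P.R_apply_sub P.φ X Y Z)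
  have hd : ∀ X, P.g (P.nab X Z) P.ξ = -P.g Z (P.N X) := fun X ↦ by
    have := P.der_eta X Z
    rw [hZ, P.der_zero] at this
    linear_combination -this
  simp only [cd_φ hP hl hlκ, hZ, zero_smul, zero_sub, P.nab_neg_right, P.nab_smul_right, P.nab_ξ,
    hd] at h
  simp only [map_add, map_sub, map_neg, map_smul, LinearMap.add_apply, LinearMap.sub_apply,
    LinearMap.neg_apply, LinearMap.smul_apply, smul_eq_mul, P.g_comm P.ξ W, hW] at h ⊢
  rw [P.g_φ]
  linear_combination h

/-- The same computation with `cd_S`. The last term is μ = 2m times η([X, Y]) = -2g(X, φY), which is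
the contact condition for horizontal X and Y. -/
lemma g_R_S {X Y Z W : V} (hX : P.g X P.ξ = 0) (hY : P.g Y P.ξ = 0) (hZ : P.g Z P.ξ = 0)
    (hW : P.g W P.ξ = 0) :
    P.g (P.R X Y (P.S Z)) W - P.g (P.R X Y Z) (P.S W) =
      (P.g (P.H X - (1 + κ) • P.φ (P.φ X)) Z * P.g (P.N Y) W
        + P.g Z (P.N Y) * P.g (P.H X - (1 + κ) • P.φ (P.φ X)) W)
      - (P.g (P.H Y - (1 + κ) • P.φ (P.φ Y)) Z * P.g (P.N X) W
        + P.g Z (P.N X) * P.g (P.H Y - (1 + κ) • P.φ (P.φ Y)) W)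
      - 4 * m * P.g X (P.φ Y) * P.g (P.H Z) W := by
  have h := congrArg (fun U ↦ P.g U W) (P.R_apply_sub P.S X Y Z)
  have hd : ∀ {U}, P.g U P.ξ = 0 → ∀ X, P.g (P.nab X U) P.ξ = -P.g U (P.N X) := by
    intro U hU X
    have := P.der_eta X U
    rw [hU, P.der_zero] at this
    linear_combination -this
  have hc := P.contact X Y
  simp only [P.nab_ξ] at hc
  simp only [cd_S hP hl hlκ, hX, hY, hZ, zero_smul, mul_zero, neg_zero, zero_sub, P.nab_neg_right,
    P.nab_smul_right, P.nab_ξ, hd hX, hd hY, hd hZ] at h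
  simp only [map_add, map_sub, map_neg, map_smul, LinearMap.add_apply, LinearMap.sub_apply,
    LinearMap.neg_apply, LinearMap.smul_apply, smul_eq_mul, P.g_comm P.ξ W, hW] at h ⊢
  rw [P.g_comm (P.N X) Y, P.g_comm (P.N Y) X] at hc
  rw [P.g_S]
  linear_combination h - 2 * m * P.g (P.H Z) W * hc

/-- The curvature of a paracontact `(κ, μ)`-module. -/
theorem g_R_eq_modelR {c : A} (hc : c * (1 + κ) = 1) (X Y Z W : V) :
    P.g (P.R X Y Z) W = P.modelR κ m c X Y Z W := by
  rw [← sub_eq_zero]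
  refine IsCurvatureLike.eq_zero hP hl hlκ
    (P.isCurvatureLike_R.sub (P.isCurvatureLike_modelR κ m c)) ?_ ?_ ?_ X Y Z W
  · intro X Y Z
    simp only [hP.R_ξ, modelR, map_add, map_sub, map_smul, LinearMap.add_apply,
      LinearMap.sub_apply, LinearMap.smul_apply, smul_eq_mul, P.η_H, P.η_φ, P.η_S, P.g_ξ_ξ,
      P.φ_ξ, LinearMap.map_zero, LinearMap.zero_apply]
    ring
  · intro X Y Z W hX hY hZ hW
    have h := g_R_φ hP hl hlκ X Y hZ hW
    simp only [P.φ_φ, hX, hY, zero_smul, sub_zero, P.N_apply] at h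
    simp only [modelR, P.g_φ, P.φ_φ, P.φ_H, P.φ_S, P.η_φ, hX, hY, hZ, hW, zero_smul, sub_zero]
    simp only [map_sub, LinearMap.sub_apply, P.g_S, P.g_φ] at h
    rw [P.g_S_swap Z X, P.g_S_swap Z Y, P.g_φ_swap Z X, P.g_φ_swap Z Y] at h
    -- The coefficients (-1 + m)c and (-κ - m)c add up to -(1 + κ)c, so `hc` clears the inverse.
    linear_combination h + (P.g (P.S X) Z * P.g (P.H Y) W - P.g (P.S Y) Z * P.g (P.H X) W
      - P.g (P.H Y) Z * P.g (P.S X) W + P.g (P.H X) Z * P.g (P.S Y) W) * hc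
  · intro X Y Z W hX hY hZ hW
    have h := g_R_S hP hl hlκ hX hY hZ hW
    simp only [P.φ_φ, hX, hY, zero_smul, sub_zero, P.N_apply, map_sub, map_smul,
      LinearMap.sub_apply, LinearMap.smul_apply, smul_eq_mul, P.g_φ, P.g_S] at h
    rw [P.g_S_swap Z X, P.g_S_swap Z Y, P.g_φ_swap Z X, P.g_φ_swap Z Y] at h
    simp only [modelR, P.g_S, P.φ_φ, P.φ_S, P.S_φ', S_H hP, S_S hP, P.η_S, hX, hY, hZ, hW, zero_smul, sub_zero, map_neg, map_smul, LinearMap.neg_apply,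
      LinearMap.smul_apply, smul_eq_mul]
    linear_combination h - ((m - 1) * (P.g (P.φ Y) Z * P.g (P.H X) W
      - P.g (P.φ X) Z * P.g (P.H Y) W - P.g (P.H Y) Z * P.g (P.φ X) W
      + P.g (P.H X) Z * P.g (P.φ Y) W) + (-κ - m) * (P.g X Z * P.g (P.S Y) W
      - P.g Y Z * P.g (P.S X) W + P.g (P.S Y) Z * P.g X W - P.g Y W * P.g (P.S X) Z)) * hc

end Nullity

end ParacontactModule
end Paracontact

/-! ### Smooth functions, smooth fields and pointwise identities. -/

namespace Paracontact

noncomputable section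

set_option linter.unusedSectionVars false

section Bundled

variable {E : Type*} [NormedAddCommGroup E] [NormedSpace ℝ E]
  {M : Type*} [TopologicalSpace M] [ChartedSpace E M] [IsManifold 𝓘(ℝ, E) ∞ M]

/-- The ring of smooth functions on `M`. -/
abbrev SmoothFn (E : Type*) [NormedAddCommGroup E] [NormedSpace ℝ E]
    (M : Type*) [TopologicalSpace M] [ChartedSpace E M] : Type _ :=
  C^∞⟮𝓘(ℝ, E), M; 𝓘(ℝ, ℝ), ℝ⟯

/-- The smooth vector fields on `M`. -/
abbrev SmoothField (E : Type*) [NormedAddCommGroup E] [NormedSpace ℝ E]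
    (M : Type*) [TopologicalSpace M] [ChartedSpace E M] [IsManifold 𝓘(ℝ, E) ∞ M] : Type _ :=
  Cₛ^∞⟮𝓘(ℝ, E); E, (TangentSpace 𝓘(ℝ, E) : M → Type _)⟯

instance : SMul (SmoothFn E M) (SmoothField E M) where
  smul f X := ⟨fun x ↦ f x • X x, f.contMDiff.smul_section X.contMDiff⟩

lemma smul_field_apply (f : SmoothFn E M) (X : SmoothField E M) (x : M) :
    (f • X) x = f x • X x := rfl

instance : Module (SmoothFn E M) (SmoothField E M) where
  one_smul X := by ext x; simp [smul_field_apply]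
  mul_smul f g X := by ext x; simp [smul_field_apply, mul_smul]
  smul_zero f := by ext x; simp [smul_field_apply]
  smul_add f X Y := by ext x; simp [smul_field_apply]
  add_smul f g X := by ext x; simp [smul_field_apply, add_smul]
  zero_smul X := by ext x; simp [smul_field_apply]

/-- A real constant as a smooth function. -/
def constFn (a : ℝ) : SmoothFn E M := ContMDiffMap.const a

lemma constFn_apply (a : ℝ) (x : M) : (constFn a : SmoothFn E M) x = a := rfl

lemma two_apply (x : M) : (2 : SmoothFn E M) x = 2 := by
  rw [← one_add_one_eq_two, ← one_add_one_eq_two]; rfl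

instance : Invertible (2 : SmoothFn E M) where
  invOf := constFn (1 / 2)
  invOf_mul_self := by
    ext x
    simp [constFn_apply, two_apply]
  mul_invOf_self := by
    ext x
    simp [constFn_apply, two_apply]

/-- Every tangent vector extends to a smooth vector field. -/
lemma exists_smoothField [FiniteDimensional ℝ E] [T2Space M] (x : M)
    (v : TangentSpace 𝓘(ℝ, E) x) : ∃ X : SmoothField E M, X x = v := by
  obtain ⟨s, hs, hsv⟩ := FiberBundle.exists_contMDiffOn_extend (k := ∞) 𝓘(ℝ, E) E v
  obtain ⟨ψ, hψ⟩ := (SmoothBumpFunction.nhds_basis_tsupport (I := 𝓘(ℝ, E)) x).mem_iff.1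
    (interior_mem_nhds.2 hs)
  have h := ψ.contMDiff.contMDiffOn (s := interior s)
  refine ⟨⟨_, ContMDiffOn.smul_section_of_tsupport h isOpen_interior hψ.2
    (hsv.mono interior_subset)⟩, ?_⟩
  change ψ x • _ = v
  simp

lemma mdifferentiableAt_field (X : SmoothField E M) (x : M) :
    MDifferentiableAt 𝓘(ℝ, E) (𝓘(ℝ, E).prod 𝓘(ℝ, E))
      (fun y ↦ TotalSpace.mk' E (E := (TangentSpace 𝓘(ℝ, E) : M → Type _)) y (X y)) x :=
  X.mdifferentiableAt

lemma mdifferentiableAt_fn (f : SmoothFn E M) (x : M) :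
    MDifferentiableAt 𝓘(ℝ, E) 𝓘(ℝ, ℝ) f x :=
  f.contMDiff.mdifferentiableAt (by simp)

/-- The covariant derivative of smooth vector fields. -/
def nablaField (D : Connection E M) (hD : CovariantDerivative.ContMDiffCovariantDerivative D ∞)
    (X Y : SmoothField E M) : SmoothField E M where
  toFun := nabla D X Y
  contMDiff_toFun := by
    have h := hD.contMDiff.contMDiff (σ := Y) (Y.contMDiff.contMDiffOn)
    exact ContMDiff.clm_bundle_apply (contMDiffOn_univ.1 h) X.contMDiff

variable {D : Connection E M} (hD : CovariantDerivative.ContMDiffCovariantDerivative D ∞)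

lemma nablaField_apply (X Y : SmoothField E M) (x : M) :
    nablaField D hD X Y x = D Y x (X x) := rfl

lemma nablaField_add_left (X X' Y : SmoothField E M) :
    nablaField D hD (X + X') Y = nablaField D hD X Y + nablaField D hD X' Y := by
  ext x
  simp [nablaField_apply]

lemma nablaField_smul_left (f : SmoothFn E M) (X Y : SmoothField E M) :
    nablaField D hD (f • X) Y = f • nablaField D hD X Y := by
  ext x
  simp [nablaField_apply, smul_field_apply]

lemma nablaField_add_right (X Y Y' : SmoothField E M) :
    nablaField D hD X (Y + Y') = nablaField D hD X Y + nablaField D hD X Y' := by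
  ext x
  have h := D.isCovariantDerivativeOnUniv.add (mdifferentiableAt_field Y x)
    (mdifferentiableAt_field Y' x)
  simp only [ContMDiffSection.coe_add, Pi.add_apply, nablaField_apply]
  rw [h, add_apply]

lemma nablaField_smul_right_apply (f : SmoothFn E M) (X Y : SmoothField E M) (x : M) :
    nablaField D hD X (f • Y) x = dirDeriv X f x • Y x + f x • nablaField D hD X Y x := by
  have h := D.isCovariantDerivativeOnUniv.leibniz (mdifferentiableAt_field Y x)
    (mdifferentiableAt_fn f x)
  rw [nablaField_apply]
  change D ((f : M → ℝ) • (Y : Field E M)) x (X x) = _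
  rw [h, add_apply, add_comm]
  rfl

end Bundled

section Structure

variable {n : ℕ} {E : Type*} [NormedAddCommGroup E] [NormedSpace ℝ E]
  {M : Type*} [TopologicalSpace M] [ChartedSpace E M] [IsManifold 𝓘(ℝ, E) ∞ M]

namespace PseudoRiemannianMetric

/-- The function `g(X, Y)` for smooth vector fields. -/
def fn (g : PseudoRiemannianMetric E M) (X Y : SmoothField E M) : SmoothFn E M where
  val x := g.val x (X x) (Y x)
  property := by
    have h := ContMDiff.clm_bundle_apply₂ (E₃ := Bundle.Trivial M ℝ) (F₃ := ℝ)
      g.contMDiff X.contMDiff Y.contMDiff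
    intro x
    have hx := h x
    simp only [contMDiffAt_totalSpace] at hx
    exact hx.2

end PseudoRiemannianMetric

namespace MetricStructure

variable (P : MetricStructure n E M)

/-- φ²ξ = 0 forces φξ = η(φξ)ξ, so ξ is an eigenvector of φ whose eigenvalue squares to zero. -/
lemma φ_ξ (x : M) : P.φ x (P.ξ x) = 0 := by
  have h₁ := P.φ_sq x (P.ξ x)
  rw [P.η_ξ, one_smul, sub_self] at h₁
  have h₂ := P.φ_sq x (P.φ x (P.ξ x))
  rw [h₁, map_zero] at h₂
  have h₃ : P.φ x (P.ξ x) = P.η x (P.φ x (P.ξ x)) • P.ξ x := (sub_eq_zero.1 h₂.symm)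
  have h₄ := h₁
  rw [h₃, map_smul, h₃, smul_smul] at h₄
  have h₅ := congrArg (P.η x) h₄
  simp only [map_smul, map_zero, P.η_ξ, smul_eq_mul, mul_one] at h₅
  rw [h₃, mul_self_eq_zero.1 h₅, zero_smul]

lemma η_φ (x : M) (v : TangentSpace 𝓘(ℝ, E) x) : P.η x (P.φ x v) = 0 := by
  have h₁ := P.φ_sq x (P.φ x v)
  rw [P.φ_sq x v, map_sub, map_smul, P.φ_ξ, smul_zero, sub_zero] at h₁
  have h₂ := congrArg (P.η x) h₁
  rw [map_sub, map_smul, P.η_ξ, smul_eq_mul, mul_one] at h₂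
  linarith

lemma g_ξ (x : M) (v : TangentSpace 𝓘(ℝ, E) x) : P.g.val x v (P.ξ x) = P.η x v := by
  have h := P.compatible x v (P.ξ x)
  rw [P.φ_ξ, map_zero, P.η_ξ] at h
  linarith

lemma g_φ (x : M) (v w : TangentSpace 𝓘(ℝ, E) x) :
    P.g.val x v (P.φ x w) = -P.g.val x (P.φ x v) w := by
  have h := P.compatible x v (P.φ x w)
  rw [P.φ_sq, P.η_φ, map_sub, map_smul, P.g_ξ, P.η_φ] at h
  simp only [smul_zero, mul_zero, sub_zero, add_zero] at h
  linarith

/-- The field `φX` for a smooth vector field `X`. -/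
def phiField (X : SmoothField E M) : SmoothField E M where
  toFun := P.phi X
  contMDiff_toFun := ContMDiff.clm_bundle_apply P.smooth_φ X.contMDiff

/-- The Reeb field as a smooth vector field. -/
def reeb : SmoothField E M := ⟨P.ξ, P.smooth_ξ⟩

end MetricStructure

end Structure

end

end Paracontact

/-! ### The manifold as an instance of the algebraic model. -/

namespace Paracontact

noncomputable section

set_option linter.unusedSectionVars false

namespace MetricStructure

variable {n : ℕ} {E : Type*} [NormedAddCommGroup E] [NormedSpace ℝ E]
  {M : Type*} [TopologicalSpace M] [ChartedSpace E M] [IsManifold 𝓘(ℝ, E) ∞ M]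
  (P : MetricStructure n E M) {D : Connection E M} (hD : IsLeviCivita P.g D)

/-- The Levi-Civita derivative of smooth vector fields. -/
abbrev nab (X Y : SmoothField E M) : SmoothField E M := nablaField D hD.smooth X Y

/-- The derivative of a smooth function along a smooth vector field. -/
def der (X : SmoothField E M) (f : SmoothFn E M) : SmoothFn E M where
  val := dirDeriv X f
  property := by
    -- X(f)ξ = ∇_X(fξ) - f∇_X ξ paired with ξ expresses X(f) through functions already known to be
    -- smooth.
    have h : dirDeriv X f = (P.g.fn (P.nab hD X (f • P.reeb)) P.reeb
        - f * P.g.fn (P.nab hD X P.reeb) P.reeb : SmoothFn E M) := by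
      ext x
      change _ = P.g.val x (P.nab hD X (f • P.reeb) x) (P.ξ x)
        - f x * P.g.val x (P.nab hD X P.reeb x) (P.ξ x)
      rw [nablaField_smul_right_apply, P.g_ξ, P.g_ξ, map_add, map_smul, map_smul]
      change _ = dirDeriv X f x • P.η x (P.ξ x) + _ - _
      rw [P.η_ξ, smul_eq_mul, smul_eq_mul]
      ring
    rw [h]
    exact ContMDiffMap.contMDiff _

include hD in
lemma der_apply (X : SmoothField E M) (f : SmoothFn E M) (x : M) :
    P.der hD X f x = mvfderiv 𝓘(ℝ, E) f x (X x) := rfl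

lemma nab_smul_right (f : SmoothFn E M) (X Y : SmoothField E M) :
    P.nab hD X (f • Y) = P.der hD X f • Y + f • P.nab hD X Y := by
  ext x
  rw [nablaField_smul_right_apply]
  rfl

/-- The Lie bracket of smooth vector fields. -/
def br (X Y : SmoothField E M) : SmoothField E M := P.nab hD X Y - P.nab hD Y X

lemma br_apply (X Y : SmoothField E M) (x : M) : P.br hD X Y x = bracket X Y x :=
  hD.torsion_free X Y x (mdifferentiableAt_field X x) (mdifferentiableAt_field Y x)

lemma coe_br (X Y : SmoothField E M) : (P.br hD X Y : Field E M) = bracket X Y :=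
  funext (P.br_apply hD X Y)

lemma br_smul_right (f : SmoothFn E M) (X Y : SmoothField E M) :
    P.br hD X (f • Y) = P.der hD X f • Y + f • P.br hD X Y := by
  rw [br, nab_smul_right]
  simp only [br, nab, nablaField_smul_left, smul_sub]
  abel

lemma br_add_right (X Y Z : SmoothField E M) :
    P.br hD X (Y + Z) = P.br hD X Y + P.br hD X Z := by
  simp only [br, nab, nablaField_add_right, nablaField_add_left]
  abel

variable [FiniteDimensional ℝ E]

lemma jacobi (X Y Z : SmoothField E M) :
    P.br hD X (P.br hD Y Z) = P.br hD (P.br hD X Y) Z + P.br hD Y (P.br hD X Z) := by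
  have : CompleteSpace E := FiniteDimensional.complete ℝ E
  have : IsManifold 𝓘(ℝ, E) (minSmoothness ℝ 3) M := by
    rw [minSmoothness_of_isRCLikeNormedField]
    exact IsManifold.of_le (n := ∞) (WithTop.coe_le_coe.2 le_top : ((3 : ℕ∞) : WithTop ℕ∞) ≤ ∞)
  have hs : ∀ X : SmoothField E M, ContMDiff 𝓘(ℝ, E) (𝓘(ℝ, E).prod 𝓘(ℝ, E))
      (minSmoothness ℝ 2)
      (fun y ↦ TotalSpace.mk' E (E := (TangentSpace 𝓘(ℝ, E) : M → Type _)) y (X y)) := fun X ↦ by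
    rw [minSmoothness_of_isRCLikeNormedField]
    exact X.contMDiff.of_le (WithTop.coe_le_coe.2 le_top : ((2 : ℕ∞) : WithTop ℕ∞) ≤ ∞)
  ext x
  rw [ContMDiffSection.coe_add, Pi.add_apply]
  simp only [br_apply, coe_br]
  exact VectorField.leibniz_identity_mlieBracket_apply (hs X x) (hs Y x) (hs Z x)

/-- The Jacobi identity for X, Y and fξ, expanded by the Leibniz rule, is this identity times ξ.
Applying η removes ξ. -/
lemma der_comm (X Y : SmoothField E M) (f : SmoothFn E M) :
    P.der hD X (P.der hD Y f) - P.der hD Y (P.der hD X f) = P.der hD (P.br hD X Y) f := by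
  have h := P.jacobi hD X Y (f • P.reeb)
  simp only [br_smul_right, br_add_right, P.jacobi hD X Y P.reeb, smul_add] at h
  have h' : (P.der hD X (P.der hD Y f) - P.der hD Y (P.der hD X f)) • P.reeb =
      P.der hD (P.br hD X Y) f • P.reeb := by
    rw [← sub_eq_zero] at h ⊢
    rw [← h]
    module
  ext x
  have hx : (P.der hD X (P.der hD Y f) - P.der hD Y (P.der hD X f)) x • P.ξ x =
      P.der hD (P.br hD X Y) f x • P.ξ x := DFunLike.congr_fun h' x
  have := congrArg (P.η x) hx
  simpa only [map_smul, P.η_ξ, smul_eq_mul, mul_one] using this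

variable [T2Space M]

/-- The smooth vector fields of a paracontact metric manifold as a paracontact module over the
ring of smooth functions. -/
def toModule : ParacontactModule (SmoothFn E M) (SmoothField E M) where
  der := P.der hD
  nab := P.nab hD
  g := LinearMap.mk₂ _ P.g.fn
    (fun X Y Z ↦ by
      ext x
      change P.g.val x (X x + Y x) (Z x) = P.g.val x (X x) (Z x) + P.g.val x (Y x) (Z x)
      rw [map_add, add_apply])
    (fun f X Y ↦ by
      ext x
      change P.g.val x (f x • X x) (Y x) = f x * P.g.val x (X x) (Y x)
      rw [map_smul, smul_apply, smul_eq_mul])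
    (fun X Y Z ↦ by
      ext x
      change P.g.val x (X x) (Y x + Z x) = P.g.val x (X x) (Y x) + P.g.val x (X x) (Z x)
      rw [map_add])
    (fun f X Y ↦ by
      ext x
      change P.g.val x (X x) (f x • Y x) = f x * P.g.val x (X x) (Y x)
      rw [map_smul, smul_eq_mul])
  φ :=
    { toFun := P.phiField
      map_add' := fun X Y ↦ by
        ext x
        exact map_add (P.φ x) (X x) (Y x)
      map_smul' := fun f X ↦ by
        ext x
        exact map_smul (P.φ x) (f x) (X x) }
  ξ := P.reeb
  der_add X f g := by
    ext x
    change mvfderiv 𝓘(ℝ, E) ((f : M → ℝ) + (g : M → ℝ)) x (X x) = _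
    rw [mvfderiv_add (mdifferentiableAt_fn f x) (mdifferentiableAt_fn g x), add_apply]
    rfl
  der_mul X f g := by
    ext x
    change mvfderiv 𝓘(ℝ, E) ((f : M → ℝ) * (g : M → ℝ)) x (X x) =
      f x * P.der hD X g x + P.der hD X f x * g x
    rw [mvfderiv_mul (mdifferentiableAt_fn f x) (mdifferentiableAt_fn g x), add_apply, smul_apply,
      smul_apply, ← P.der_apply hD, ← P.der_apply hD, smul_eq_mul, smul_eq_mul]
    ring
  nab_add_left := nablaField_add_left hD.smooth
  nab_smul_left := nablaField_smul_left hD.smooth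
  nab_add_right := nablaField_add_right hD.smooth
  nab_smul_right f X Y := P.nab_smul_right hD f X Y
  der_comm := P.der_comm hD
  bianchi X Y Z := by
    -- For a torsion-free connection the first Bianchi identity is the Jacobi identity.
    have h := P.jacobi hD X Y Z
    have hsub : ∀ X Y Z, P.nab hD X (Y - Z) = P.nab hD X Y - P.nab hD X Z := fun X Y Z ↦ by
      rw [eq_sub_iff_add_eq, ← nablaField_add_right, sub_add_cancel]
    have hsub' : ∀ X Y Z, P.nab hD (X - Y) Z = P.nab hD X Z - P.nab hD Y Z := fun X Y Z ↦ by
      rw [eq_sub_iff_add_eq, ← nablaField_add_left, sub_add_cancel]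
    simp only [br, hsub, hsub'] at h ⊢
    rw [← sub_eq_zero] at h
    rw [← h]
    abel
  g_comm X Y := by
    ext x
    exact P.g.symm x (X x) (Y x)
  g_nondeg X h := by
    ext x
    refine P.g.nondegenerate x _ fun w ↦ ?_
    obtain ⟨W, rfl⟩ := exists_smoothField x w
    exact DFunLike.congr_fun (h W) x
  der_g X Y Z := by
    ext x
    exact hD.metric X Y Z x (mdifferentiableAt_field Y x) (mdifferentiableAt_field Z x)
  g_ξ_ξ := by
    ext x
    exact (P.g_ξ x (P.ξ x)).trans (P.η_ξ x)
  φ_ξ := by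
    ext x
    exact P.φ_ξ x
  φ_φ X := by
    ext x
    change P.φ x (P.φ x (X x)) = X x - P.g.val x (X x) (P.ξ x) • P.ξ x
    rw [P.φ_sq, P.g_ξ]
  g_φ X Y := by
    ext x
    exact P.g_φ x (X x) (Y x)
  contact X Y := by
    ext x
    have h := P.contact X Y X.contMDiff Y.contMDiff x
    have h₁ := hD.metric X Y P.ξ x (mdifferentiableAt_field Y x) (mdifferentiableAt_field P.reeb x)
    have h₂ := hD.metric Y X P.ξ x (mdifferentiableAt_field X x) (mdifferentiableAt_field P.reeb x)
    have h₃ := hD.torsion_free X Y x (mdifferentiableAt_field X x) (mdifferentiableAt_field Y x)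
    -- With η = g(·, ξ), the terms η(∇_X Y) and η(∇_Y X) in dη cancel against η([X, Y]).
    simp only [P.g_ξ] at h₁ h₂
    rw [extDerivOneForm, h₁, h₂, ← h₃, map_sub] at h
    have h₄ := P.g.symm x (Y x) (nabla D X P.ξ x)
    have h₅ := P.g.symm x (X x) (nabla D Y P.ξ x)
    change P.g.val x (nabla D X P.ξ x) (Y x) - P.g.val x (nabla D Y P.ξ x) (X x) =
      (2 : SmoothFn E M) x * P.g.val x (X x) (P.φ x (Y x))
    rw [two_apply]
    linarith

lemma toModule_φ_apply (X : SmoothField E M) (x : M) :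
    (P.toModule hD).φ X x = P.phi X x := rfl

lemma toModule_g_ξ_apply (X : SmoothField E M) (x : M) :
    (P.toModule hD).g X (P.toModule hD).ξ x = P.eta X x := P.g_ξ x (X x)

lemma toModule_R_apply (X Y Z : SmoothField E M) (x : M) :
    (P.toModule hD).R X Y Z x = curvature D X Y Z x := by
  have h : (P.toModule hD).R X Y Z x =
      nabla D X (nabla D Y Z) x - nabla D Y (nabla D X Z) x - nabla D (P.br hD X Y) Z x := rfl
  rw [h, coe_br]
  rfl

lemma toModule_H_apply (X : SmoothField E M) (x : M) :
    (P.toModule hD).H X x = P.h X x := by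
  have h := DFunLike.congr_fun ((P.toModule hD).two_smul_H X) x
  have h₁ : ((2 : SmoothFn E M) • (P.toModule hD).H X) x = (2 : ℝ) • (P.toModule hD).H X x := by
    rw [smul_field_apply, two_apply]
  have h₂ : ((P.br hD P.reeb (P.phiField X)) - P.phiField (P.br hD P.reeb X)) x =
      bracket P.ξ (P.phi X) x - P.phi (bracket P.ξ X) x := by
    change P.br hD P.reeb (P.phiField X) x - P.φ x (P.br hD P.reeb X x) = _
    rw [br_apply, br_apply]
    rfl
  have h₃ : (2 : ℝ) • (P.toModule hD).H X x =
      bracket P.ξ (P.phi X) x - P.phi (bracket P.ξ X) x := by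
    rw [← h₁, ← h₂]
    exact h
  change _ = (1 / 2 : ℝ) • (bracket P.ξ (P.phi X) x - P.phi (bracket P.ξ X) x)
  rw [← h₃, smul_smul]
  norm_num

lemma toModule_S_apply (X : SmoothField E M) (x : M) :
    (P.toModule hD).S X x = P.phi (P.h X) x := by
  rw [← ParacontactModule.φ_H]
  change P.φ x ((P.toModule hD).H X x) = _
  rw [toModule_H_apply]
  rfl

end MetricStructure

end

end Paracontact

/-! ### The curvature formulas on the manifold. -/

namespace Paracontact

set_option linter.unusedSectionVars false

namespace MetricStructure

variable {n : ℕ} {E : Type*} [NormedAddCommGroup E] [NormedSpace ℝ E] [FiniteDimensional ℝ E]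
  {M : Type*} [TopologicalSpace M] [ChartedSpace E M] [IsManifold 𝓘(ℝ, E) ∞ M] [T2Space M]
  (P : MetricStructure n E M) {D : Connection E M} (hD : IsLeviCivita P.g D)

lemma isNullity_toModule {κ μ : ℝ} (hnull : P.Nullity D κ μ) :
    (P.toModule hD).IsNullity (constFn κ) (2 * constFn (μ / 2)) where
  der_κ X := by
    ext x
    change mvfderiv 𝓘(ℝ, E) (fun _ : M ↦ κ) x (X x) = 0
    rw [mvfderiv_const]
    rfl
  R_ξ X Y := by
    ext x
    have h := hnull X Y X.contMDiff Y.contMDiff x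
    rw [toModule_R_apply]
    change curvature D X Y P.ξ x = κ • ((P.toModule hD).g Y (P.toModule hD).ξ x • X x
      - (P.toModule hD).g X (P.toModule hD).ξ x • Y x) + ((2 : SmoothFn E M) x * (μ / 2)) •
        ((P.toModule hD).g Y (P.toModule hD).ξ x • (P.toModule hD).H X x
          - (P.toModule hD).g X (P.toModule hD).ξ x • (P.toModule hD).H Y x)
    rw [h]
    simp only [toModule_g_ξ_apply, toModule_H_apply, two_apply]
    rw [mul_div_cancel₀ μ (two_ne_zero' ℝ)]

/-- Tangent vectors with the same scalar products with all smooth fields are equal. -/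
lemma ext_ip {x : M} {v w : TangentSpace 𝓘(ℝ, E) x}
    (h : ∀ W : SmoothField E M, P.g.val x v (W x) = P.g.val x w (W x)) : v = w := by
  rw [← sub_eq_zero]
  refine P.g.nondegenerate x _ fun u ↦ ?_
  obtain ⟨W, rfl⟩ := exists_smoothField x u
  rw [map_sub, sub_apply, h, sub_self]

variable {κ μ : ℝ}
include hD

/-- The curvature tensor of a paracontact `(κ, μ)`-manifold with `κ > -1`. -/
theorem ip_curvature (hnull : P.Nullity D κ μ) (hκ : -1 < κ) (X Y Z W : SmoothField E M) (x : M) :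
    P.ip (curvature D X Y Z) W x =
      (-1 + μ / 2) * (P.ip Y Z x * P.ip X W x - P.ip X Z x * P.ip Y W x)
      + P.ip Y Z x * P.ip (P.h X) W x - P.ip X Z x * P.ip (P.h Y) W x
      - P.ip Y W x * P.ip (P.h X) Z x + P.ip X W x * P.ip (P.h Y) Z x
      + (-1 + μ / 2) / (κ + 1) *
          (P.ip (P.h Y) Z x * P.ip (P.h X) W x - P.ip (P.h X) Z x * P.ip (P.h Y) W x)
      - μ / 2 *
          (P.ip (P.phi Y) Z x * P.ip (P.phi X) W x - P.ip (P.phi X) Z x * P.ip (P.phi Y) W x)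
      + (-κ - μ / 2) / (κ + 1) *
          (P.ip (P.phi (P.h Y)) Z x * P.ip (P.phi (P.h X)) W x
            - P.ip (P.phi (P.h Y)) W x * P.ip (P.phi (P.h X)) Z x)
      + μ * P.ip (P.phi X) Y x * P.ip (P.phi Z) W x
      + P.eta X x * P.eta W x *
          ((κ + 1 - μ / 2) * P.ip Y Z x + (μ - 1) * P.ip (P.h Y) Z x)
      - P.eta X x * P.eta Z x *
          ((κ + 1 - μ / 2) * P.ip Y W x + (μ - 1) * P.ip (P.h Y) W x)
      + P.eta Y x * P.eta Z x *
          ((κ + 1 - μ / 2) * P.ip X W x + (μ - 1) * P.ip (P.h X) W x)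
      - P.eta Y x * P.eta W x *
          ((κ + 1 - μ / 2) * P.ip X Z x + (μ - 1) * P.ip (P.h X) Z x) := by
  have hpos : 0 < 1 + κ := by linarith
  have hl : (constFn (√(1 + κ))⁻¹ : SmoothFn E M) * constFn (√(1 + κ)) = 1 := by
    ext x
    exact inv_mul_cancel₀ (Real.sqrt_pos.2 hpos).ne'
  have hlκ : (constFn (√(1 + κ)) : SmoothFn E M) * constFn (√(1 + κ)) = 1 + constFn κ := by
    ext x
    exact Real.mul_self_sqrt hpos.le
  have hc : (constFn (κ + 1)⁻¹ : SmoothFn E M) * (1 + constFn κ) = 1 := by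
    ext x
    change (κ + 1)⁻¹ * (1 + κ) = 1
    rw [add_comm 1 κ]
    exact inv_mul_cancel₀ (by linarith)
  have h := congrArg (ContMDiffMap.evalRingHom x)
    (ParacontactModule.g_R_eq_modelR (P.isNullity_toModule hD hnull) hl hlκ hc X Y Z W)
  simp only [ParacontactModule.modelR, map_add, map_sub, map_mul, map_neg, map_one, map_ofNat] at h
  have ev : ∀ f : SmoothFn E M, ContMDiffMap.evalRingHom x f = f x := fun _ ↦ rfl
  have hg : ∀ X Y : SmoothField E M, (P.toModule hD).g X Y x = P.g.val x (X x) (Y x) :=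
    fun _ _ ↦ rfl
  simp only [ev, toModule_g_ξ_apply] at h
  simp only [hg, constFn_apply, toModule_R_apply, toModule_H_apply, toModule_φ_apply,
    toModule_S_apply] at h
  simp only [ip, div_eq_mul_inv _ (κ + 1)]
  linear_combination h

lemma ip_h (X Y : SmoothField E M) (x : M) : P.ip X (P.h Y) x = P.ip (P.h X) Y x := by
  have h := DFunLike.congr_fun ((P.toModule hD).g_H X Y) x
  change P.g.val x (X x) ((P.toModule hD).H Y x) = P.g.val x ((P.toModule hD).H X x) (Y x) at h
  rwa [toModule_H_apply, toModule_H_apply] at h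

lemma eta_h (X : SmoothField E M) (x : M) : P.eta (P.h X) x = 0 := by
  have h := DFunLike.congr_fun ((P.toModule hD).η_H X) x
  rw [toModule_g_ξ_apply, eta, toModule_H_apply] at h
  exact h

lemma h_phi (X : SmoothField E M) (x : M) : P.h (P.phi X) x = -P.phi (P.h X) x := by
  have h := DFunLike.congr_fun ((P.toModule hD).H_φ X) x
  rw [toModule_H_apply, ContMDiffSection.coe_neg, Pi.neg_apply, toModule_S_apply] at h
  exact h

lemma eta_of_inEigen {c : ℝ} (hc : c ≠ 0) {X : SmoothField E M} {x : M} (hX : P.InEigen c X x) :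
    P.η x (X x) = 0 := by
  have h := P.eta_h hD X x
  rw [eta, hX, map_smul, smul_eq_mul] at h
  exact (mul_eq_zero.1 h).resolve_left hc

lemma ip_of_inEigen {c : ℝ} (hc : c ≠ 0) {X Y : SmoothField E M} {x : M}
    (hX : P.InEigen c X x) (hY : P.InEigen (-c) Y x) : P.g.val x (X x) (Y x) = 0 := by
  have h := P.ip_h hD X Y x
  rw [ip, ip, show P.h X x = c • X x from hX, show P.h Y x = -c • Y x from hY, map_smul, map_smul,
    smul_apply, smul_eq_mul, smul_eq_mul] at h
  exact (mul_eq_zero.1 (by linarith : c * P.g.val x (X x) (Y x) = 0)).resolve_left hc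

lemma ip_phi_of_inEigen {c : ℝ} (hc : c ≠ 0) {X Y : SmoothField E M} {x : M}
    (hX : P.InEigen c X x) (hY : P.InEigen c Y x) : P.g.val x (P.φ x (X x)) (Y x) = 0 := by
  have h : P.h (P.phi X) x = -c • P.phi X x := by
    rw [P.h_phi hD, phi, hX, map_smul, neg_smul]
    rfl
  rw [P.g.symm]
  exact P.ip_of_inEigen hD (Y := P.phiField X) hc hY h

/-- The curvature `R_{XY}` on eigenvectors `X`, `Y` of `h` with eigenvalues `a`, `b ≠ 0`. -/
theorem curvature_of_inEigen (hnull : P.Nullity D κ μ) (hκ : -1 < κ) {a b e : ℝ} (ha : a ≠ 0)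
    (hb : b ≠ 0) (he : a * b = e * (κ + 1)) {X Y Z : SmoothField E M} {x : M}
    (hX : P.InEigen a X x) (hY : P.InEigen b Y x) :
    curvature D X Y Z x =
      ((-1 + μ / 2) * (1 + e) + a + b) • (P.ip Y Z x • X x - P.ip X Z x • Y x)
        - (μ / 2 + (κ + μ / 2) * e) • (P.ip (P.phi Y) Z x • P.phi X x
          - P.ip (P.phi X) Z x • P.phi Y x)
        + (μ * P.ip (P.phi X) Y x) • P.phi Z x := by
  refine P.ext_ip fun W ↦ ?_
  have h := P.ip_curvature hD hnull hκ X Y Z W x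
  have hX' : P.h X x = a • X x := hX
  have hY' : P.h Y x = b • Y x := hY
  have hηX := P.eta_of_inEigen hD ha hX
  have hηY := P.eta_of_inEigen hD hb hY
  have hκ' : κ + 1 ≠ 0 := by linarith
  -- In the application a and b are ±√(1+κ), so e is 1 for equal signs and -1 for opposite ones, and
  -- one formula serves every case of (a).
  have he' : a * b * (κ + 1)⁻¹ = e := by rw [he, mul_inv_cancel_right₀ hκ']
  simp only [ip, phi, eta, hX', hY', hηX, hηY, map_smul, map_sub, map_add, smul_apply,
    sub_apply, add_apply, smul_eq_mul, div_eq_mul_inv _ (κ + 1)] at h ⊢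
  rw [← he']
  linear_combination h

end MetricStructure

end Paracontact

theorem corollary4p12 (n : ℕ)
    {E : Type*} [NormedAddCommGroup E] [NormedSpace ℝ E] [FiniteDimensional ℝ E]
    (hdim : Module.finrank ℝ E = 2 * n + 1)
    {M : Type*} [TopologicalSpace M] [T2Space M] [SecondCountableTopology M]
    [ChartedSpace E M] [IsManifold 𝓘(ℝ, E) ∞ M]
    (P : Paracontact.MetricStructure n E M)
    (D : Paracontact.Connection E M) (hD : Paracontact.IsLeviCivita P.g D)
    (κ μ : ℝ) (hnull : P.Nullity D κ μ) (hκ : -1 < κ) :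
    -- the curvature on the eigendistributions of `h`
    (∀ X X' X'' Y Y' Y'' : Paracontact.Field E M,
      Paracontact.IsSmooth X → Paracontact.IsSmooth X' → Paracontact.IsSmooth X'' →
      Paracontact.IsSmooth Y → Paracontact.IsSmooth Y' → Paracontact.IsSmooth Y'' →
      ∀ x : M,
      P.InEigen (√(1 + κ)) X x → P.InEigen (√(1 + κ)) X' x → P.InEigen (√(1 + κ)) X'' x →
      P.InEigen (-√(1 + κ)) Y x → P.InEigen (-√(1 + κ)) Y' x → P.InEigen (-√(1 + κ)) Y'' x →
      Paracontact.curvature D X X' X'' x =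
          (2 * (√(1 + κ) - 1) + μ) • (P.ip X' X'' x • X x - P.ip X X'' x • X' x) ∧
      Paracontact.curvature D X X' Y x =
          (κ + μ) • (-(P.ip (P.phi X') Y x) • P.phi X x + P.ip (P.phi X) Y x • P.phi X' x) ∧
      Paracontact.curvature D X Y X' x =
          (κ * P.ip (P.phi Y) X' x) • P.phi X x - (μ * P.ip (P.phi Y) X x) • P.phi X' x ∧
      Paracontact.curvature D X Y Y' x =
          -(κ * P.ip (P.phi X) Y' x) • P.phi Y x + (μ * P.ip (P.phi X) Y x) • P.phi Y' x ∧
      Paracontact.curvature D Y Y' X x =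
          (κ + μ) • (-(P.ip (P.phi Y') X x) • P.phi Y x + P.ip (P.phi Y) X x • P.phi Y' x) ∧
      Paracontact.curvature D Y Y' Y'' x =
          (-2 * (√(1 + κ) + 1) + μ) • (P.ip Y' Y'' x • Y x - P.ip Y Y'' x • Y' x)) ∧
    -- the full curvature tensor
    (∀ X Y Z W : Paracontact.Field E M,
      Paracontact.IsSmooth X → Paracontact.IsSmooth Y →
      Paracontact.IsSmooth Z → Paracontact.IsSmooth W →
      ∀ x : M,
      P.ip (Paracontact.curvature D X Y Z) W x =
        (-1 + μ / 2) * (P.ip Y Z x * P.ip X W x - P.ip X Z x * P.ip Y W x)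
        + P.ip Y Z x * P.ip (P.h X) W x - P.ip X Z x * P.ip (P.h Y) W x
        - P.ip Y W x * P.ip (P.h X) Z x + P.ip X W x * P.ip (P.h Y) Z x
        + (-1 + μ / 2) / (κ + 1) *
            (P.ip (P.h Y) Z x * P.ip (P.h X) W x - P.ip (P.h X) Z x * P.ip (P.h Y) W x)
        - μ / 2 *
            (P.ip (P.phi Y) Z x * P.ip (P.phi X) W x - P.ip (P.phi X) Z x * P.ip (P.phi Y) W x)
        + (-κ - μ / 2) / (κ + 1) *
            (P.ip (P.phi (P.h Y)) Z x * P.ip (P.phi (P.h X)) W x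
              - P.ip (P.phi (P.h Y)) W x * P.ip (P.phi (P.h X)) Z x)
        + μ * P.ip (P.phi X) Y x * P.ip (P.phi Z) W x
        + P.eta X x * P.eta W x *
            ((κ + 1 - μ / 2) * P.ip Y Z x + (μ - 1) * P.ip (P.h Y) Z x)
        - P.eta X x * P.eta Z x *
            ((κ + 1 - μ / 2) * P.ip Y W x + (μ - 1) * P.ip (P.h Y) W x)
        + P.eta Y x * P.eta Z x *
            ((κ + 1 - μ / 2) * P.ip X W x + (μ - 1) * P.ip (P.h X) W x)
        - P.eta Y x * P.eta W x *
            ((κ + 1 - μ / 2) * P.ip X Z x + (μ - 1) * P.ip (P.h X) Z x)) := by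
  refine ⟨fun X X' X'' Y Y' Y'' sX sX' sX'' sY sY' sY'' x hX hX' hX'' hY hY' hY'' ↦ ?_,
    fun X Y Z W sX sY sZ sW x ↦
      P.ip_curvature hD hnull hκ ⟨X, sX⟩ ⟨Y, sY⟩ ⟨Z, sZ⟩ ⟨W, sW⟩ x⟩
  have hl : √(1 + κ) ≠ 0 := (Real.sqrt_pos.2 (by linarith)).ne'
  have hll : √(1 + κ) * √(1 + κ) = κ + 1 := by rw [Real.mul_self_sqrt (by linarith), add_comm]
  -- From here only l ≠ 0 and l² = κ + 1 matter.
  generalize √(1 + κ) = l at *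
  have hl' : -l ≠ 0 := neg_ne_zero.2 hl
  have hpp : l * l = 1 * (κ + 1) := by linarith
  have hpm : l * -l = -1 * (κ + 1) := by linarith
  have hmm : -l * -l = 1 * (κ + 1) := by linarith
  obtain ⟨X, rfl⟩ : ∃ V : Paracontact.SmoothField E M, X = V := ⟨⟨X, sX⟩, rfl⟩
  obtain ⟨X', rfl⟩ : ∃ V : Paracontact.SmoothField E M, X' = V := ⟨⟨X', sX'⟩, rfl⟩
  obtain ⟨X'', rfl⟩ : ∃ V : Paracontact.SmoothField E M, X'' = V := ⟨⟨X'', sX''⟩, rfl⟩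
  obtain ⟨Y, rfl⟩ : ∃ V : Paracontact.SmoothField E M, Y = V := ⟨⟨Y, sY⟩, rfl⟩
  obtain ⟨Y', rfl⟩ : ∃ V : Paracontact.SmoothField E M, Y' = V := ⟨⟨Y', sY'⟩, rfl⟩
  obtain ⟨Y'', rfl⟩ : ∃ V : Paracontact.SmoothField E M, Y'' = V := ⟨⟨Y'', sY''⟩, rfl⟩
  have gpm {U V : Paracontact.SmoothField E M} (hU : P.InEigen l U x) (hV : P.InEigen (-l) V x) :
      P.ip U V x = 0 := P.ip_of_inEigen hD hl hU hV
  have gmp {U V : Paracontact.SmoothField E M} (hU : P.InEigen l U x) (hV : P.InEigen (-l) V x) :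
      P.ip V U x = 0 := (P.g.symm x _ _).trans (gpm hU hV)
  have φp {U V : Paracontact.SmoothField E M} (hU : P.InEigen l U x) (hV : P.InEigen l V x) :
      P.ip (P.phi U) V x = 0 := P.ip_phi_of_inEigen hD hl hU hV
  have φm {U V : Paracontact.SmoothField E M} (hU : P.InEigen (-l) U x)
      (hV : P.InEigen (-l) V x) : P.ip (P.phi U) V x = 0 := P.ip_phi_of_inEigen hD hl' hU hV
  have φs (U V : Paracontact.SmoothField E M) : P.ip (P.phi U) V x = -P.ip (P.phi V) U x :=
    (P.g.symm x _ _).trans (P.g_φ x _ _)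
  refine ⟨?_, ?_, ?_, ?_, ?_, ?_⟩
  · rw [P.curvature_of_inEigen hD hnull hκ hl hl hpp hX hX', φp hX hX', φp hX hX'',
      φp hX' hX'']
    module
  · rw [P.curvature_of_inEigen hD hnull hκ hl hl hpp hX hX', φp hX hX', gpm hX hY,
      gpm hX' hY]
    module
  · rw [P.curvature_of_inEigen hD hnull hκ hl hl' hpm hX hY, gmp hX' hY, φp hX hX', φs X Y]
    module
  · rw [P.curvature_of_inEigen hD hnull hκ hl hl' hpm hX hY, gpm hX hY', φm hY hY']
    module
  · rw [P.curvature_of_inEigen hD hnull hκ hl' hl' hmm hY hY', φm hY hY', gmp hX hY,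
      gmp hX hY']
    module
  · rw [P.curvature_of_inEigen hD hnull hκ hl' hl' hmm hY hY', φm hY hY', φm hY hY'',
      φm hY' hY'']
    module
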